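/- For positive integers $m,n$ let $X_1,\dots,X_m,Y_1,\dots,Y_n$ be i.i.d. real random variables with a continuous distribution function $F$ (the null hypothesis $H_0$), let $F_m$ and $G_n$ be the empirical distribution functions of $X_1,\dots,X_m$ and of $Y_1,\dots,Y_n$, and let $$KS_{m,n}=\sqrt{\frac{mn}{m+n}}\;\sup_{x\in\mathbb R}|F_m(x)-G_n(x)|.$$ The possible positive values of $KS_{n,n}$ are $M=k/\sqrt{2n}$, $k=1,\dots,n$. Say that $\mathrm{DKW}(n,C)$ holds if, under $H_0$, $\Pr(KS_{n,n}\ge M)\le C e^{-2M^2}$ for all $M>0$. Then: (a) $\mathrm{DKW}(n,e)$ holds for all $n\ge 1$. (b) $\mathrm{DKW}(n,2.16863)$ holds for all $n\ge 4$; moreover $4$ is the smallest $n\ge1$ such that $H_0$ can be rejected at level $0.05$, i.e. such that $\Pr(KS_{n,n}\ge M)\le 0.05$ for some possible value $M$. (c) $\mathrm{DKW}(n,2)$ holds for all $n\ge 458$. (d) For each $n$ with $1\le n<458$ there is a possible value $M=k/\sqrt{2n}$, $1\le k\le n$, such that $\Pr(KS_{n,n}\ge M)>2e^{-2M^2}$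 under $H_0$. (e) For each $n$ with $1\le n<458$ there is a $\delta_n>0$ such that $\mathrm{DKW}(n,2(1+\delta_n))$ holds, where for $12\le n\le 457$ $$\delta_n<-\frac{0.07}{n}+\frac{40}{n^2}-\frac{400}{n^3}.$$ -/

import Mathlib

open MeasureTheory ProbabilityTheory

universe u

namespace TwoSample

/-- Empirical distribution function of the sample `x 0, …, x (n - 1)`:
the fraction of the sample points that are `≤ t`. -/
noncomputable def empiricalDF {n : ℕ} (x : Fin n → ℝ) (t : ℝ) : ℝ :=
  (Nat.card {i : Fin n // x i ≤ t} : ℝ) / (n : ℝ)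

/-- The statistic `D_{m,n} = sup_t |F_m(t) - G_n(t)|` of two samples. -/
noncomputable def statD {m n : ℕ} (x : Fin m → ℝ) (y : Fin n → ℝ) : ℝ :=
  ⨆ t : ℝ, |empiricalDF x t - empiricalDF y t|

/-- The two-sample Kolmogorov–Smirnov statistic `KS_{m,n} = √(mn/(m+n)) D_{m,n}`. -/
noncomputable def statKS {m n : ℕ} (x : Fin m → ℝ) (y : Fin n → ℝ) : ℝ :=
  Real.sqrt ((m : ℝ) * (n : ℝ) / ((m : ℝ) + (n : ℝ))) * statD x y

/-- The null hypothesis `H₀`: the `m + n` real random variables `X 0, …, X (m - 1)`,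
`Y 0, …, Y (n - 1)` are independent and all have the same continuous distribution function `F`. -/
structure NullHypothesis {m n : ℕ} {Ω : Type u} [MeasurableSpace Ω] (P : Measure Ω)
    (F : ℝ → ℝ) (X : Fin m → Ω → ℝ) (Y : Fin n → Ω → ℝ) : Prop where
  continuous_F : Continuous F
  measurable_X : ∀ i, Measurable (X i)
  measurable_Y : ∀ j, Measurable (Y j)
  df_X : ∀ i t, P.real {ω | X i ω ≤ t} = F t
  df_Y : ∀ j t, P.real {ω | Y j ω ≤ t} = F t
  indep : iIndepFun (Sum.elim X Y) P

/-- The event-probability `P(KS_{m,n} ≥ M)`. -/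
noncomputable def tailProb {m n : ℕ} {Ω : Type u} [MeasurableSpace Ω] (P : Measure Ω)
    (X : Fin m → Ω → ℝ) (Y : Fin n → Ω → ℝ) (M : ℝ) : ℝ :=
  P.real {ω | M ≤ statKS (fun i => X i ω) (fun j => Y j ω)}

/-- The possible values `√(mn/(m+n)) k / lcm(m,n)`, `1 ≤ k ≤ lcm(m,n)`, of `KS_{m,n}`. -/
noncomputable def possibleM (m n k : ℕ) : ℝ :=
  Real.sqrt ((m : ℝ) * (n : ℝ) / ((m : ℝ) + (n : ℝ))) * (k : ℝ) / (Nat.lcm m n : ℝ)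

/-- The DKW inequality holds in the two-sample case for `m`, `n` and the constant `C`:
under `H₀`, for every `M > 0`, `P(KS_{m,n} ≥ M) ≤ C exp(-2M²)`. -/
def DKWHolds (m n : ℕ) (C : ℝ) : Prop :=
  ∀ (Ω : Type u) [MeasurableSpace Ω] (P : Measure Ω) [IsProbabilityMeasure P]
    (F : ℝ → ℝ) (X : Fin m → Ω → ℝ) (Y : Fin n → Ω → ℝ),
    NullHypothesis P F X Y → ∀ M : ℝ, 0 < M → tailProb P X Y M ≤ C * Real.exp (-2 * M ^ 2)

/-- The DKW inequality with constant `C` fails at the value `M`, whatever the samples under `H₀`. -/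
def DKWFailsAt (m n : ℕ) (C M : ℝ) : Prop :=
  ∀ (Ω : Type u) [MeasurableSpace Ω] (P : Measure Ω) [IsProbabilityMeasure P]
    (F : ℝ → ℝ) (X : Fin m → Ω → ℝ) (Y : Fin n → Ω → ℝ),
    NullHypothesis P F X Y → C * Real.exp (-2 * M ^ 2) < tailProb P X Y M

/-- `H₀` can be rejected at level `α` by the Kolmogorov–Smirnov test with sample sizes `m`, `n`:
some possible value `M` of `KS_{m,n}` has a `p`-value `P(KS_{m,n} ≥ M)` of at most `α`. -/
def CanReject (m n : ℕ) (α : ℝ) : Prop :=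
  ∃ k : ℕ, 1 ≤ k ∧ k ≤ Nat.lcm m n ∧
    ∀ (Ω : Type u) [MeasurableSpace Ω] (P : Measure Ω) [IsProbabilityMeasure P]
      (F : ℝ → ℝ) (X : Fin m → Ω → ℝ) (Y : Fin n → Ω → ℝ),
      NullHypothesis P F X Y → tailProb P X Y (possibleM m n k) ≤ α

end TwoSample

namespace TwoSample

open Finset

/-- The ratio `C(2n, n + k) / C(2n, n)` as a product. -/
noncomputable def centralRatio (n k : ℕ) : ℝ :=
  ∏ i ∈ range k, ((n - i : ℕ) : ℝ) / ((n : ℝ) + i + 1)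

theorem centralRatio_nonneg (n k : ℕ) : 0 ≤ centralRatio n k :=
  prod_nonneg fun _ _ => by positivity

theorem centralRatio_eq (n k : ℕ) :
    centralRatio n k = ((2 * n).choose (n + k) : ℝ) / (2 * n).choose n := by
  have hpos : (0 : ℝ) < (2 * n).choose n := by
    exact_mod_cast Nat.choose_pos (by omega)
  induction k with
  | zero => simp [centralRatio, hpos.ne']
  | succ k ih =>
    have hstep : ((2 * n).choose (n + k + 1) : ℝ) * ((n : ℝ) + k + 1)
        = (2 * n).choose (n + k) * ((n - k : ℕ) : ℝ) := by
      have h := Nat.choose_succ_right_eq (2 * n) (n + k)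
      rw [show 2 * n - (n + k) = n - k by omega] at h
      exact_mod_cast h
    have hk : (0 : ℝ) < (n : ℝ) + k + 1 := by positivity
    rw [centralRatio, prod_range_succ, ← centralRatio, ih, ← add_assoc, div_mul_div_comm,
      div_eq_div_iff (by positivity) hpos.ne', ← hstep]
    ring

theorem centralRatio_add (n a k : ℕ) :
    centralRatio n (a + k) = centralRatio n a *
      ∏ i ∈ range k, ((n - (a + i) : ℕ) : ℝ) / ((n : ℝ) + (a + i : ℕ) + 1) := by
  rw [centralRatio, prod_range_add]
  rfl

/-- The product `∏_{i < k} (n - a - i)`, in a form that the kernel evaluates quickly. -/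
def descProd (n a k : ℕ) : ℕ := Nat.rec 1 (fun i ih => (n - (a + i)) * ih) k

/-- The product `∏_{i < k} (n + a + i + 1)`, in a form that the kernel evaluates quickly. -/
def ascProd (n a k : ℕ) : ℕ := Nat.rec 1 (fun i ih => (n + (a + i) + 1) * ih) k

/-- The integer `m! q ^ m ∑_{i ≤ m} (p / q) ^ i / i!`. -/
def expNum (p q m : ℕ) : ℕ := Nat.rec 1 (fun i ih => (i + 1) * q * ih + p ^ (i + 1)) m

theorem descProd_eq (n a k : ℕ) : descProd n a k = ∏ i ∈ range k, (n - (a + i)) := by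
  induction k with
  | zero => rfl
  | succ k ih => rw [prod_range_succ, ← ih, mul_comm]; rfl

theorem ascProd_eq (n a k : ℕ) : ascProd n a k = ∏ i ∈ range k, (n + (a + i) + 1) := by
  induction k with
  | zero => rfl
  | succ k ih => rw [prod_range_succ, ← ih, mul_comm]; rfl

theorem ascProd_pos (n a k : ℕ) : 0 < ascProd n a k := by
  rw [ascProd_eq]; exact prod_pos fun _ _ => by omega

theorem descProd_le_ascProd (n a k : ℕ) : descProd n a k ≤ ascProd n a k := by
  rw [ascProd_eq, descProd_eq]; exact prod_le_prod' fun _ _ => by omega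

theorem prod_ratio_eq (n a k : ℕ) :
    ∏ i ∈ range k, ((n - (a + i) : ℕ) : ℝ) / ((n : ℝ) + (a + i : ℕ) + 1)
      = descProd n a k / ascProd n a k := by
  rw [ascProd_eq, descProd_eq, prod_div_distrib]
  push_cast
  rfl

theorem centralRatio_eq_prods (n k : ℕ) :
    centralRatio n k = descProd n 0 k / ascProd n 0 k := by
  rw [← prod_ratio_eq]
  simp [centralRatio]

theorem centralRatio_add_eq (n a k : ℕ) :
    centralRatio n (a + k) = centralRatio n a * (descProd n a k / ascProd n a k) := by
  rw [centralRatio_add, prod_ratio_eq]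

theorem expNum_eq (p q m : ℕ) (hq : 0 < q) :
    (expNum p q m : ℝ) = (m.factorial * q ^ m : ℝ) *
      ∑ i ∈ range (m + 1), ((p : ℝ) / q) ^ i / i.factorial := by
  have hq' : (q : ℝ) ≠ 0 := by exact_mod_cast hq.ne'
  induction m with
  | zero => simp [expNum]
  | succ m ih =>
    have h : expNum p q (m + 1) = (m + 1) * q * expNum p q m + p ^ (m + 1) := rfl
    have hf : (m.factorial : ℝ) ≠ 0 := by exact_mod_cast m.factorial_ne_zero
    rw [h, sum_range_succ]
    push_cast
    rw [ih, Nat.factorial_succ, div_pow]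
    generalize (∑ i ∈ range (m + 1), _ : ℝ) = s
    push_cast
    field_simp
    ring

theorem exp_le_sum_add {x : ℝ} {m : ℕ} (hx : 0 ≤ x) (hm : 2 * x ≤ m + 1) :
    Real.exp x ≤ ∑ i ∈ range m, x ^ i / i.factorial + x ^ m / m.factorial * 2 := by
  have hn : ‖(x : ℂ)‖ = x := by rw [Complex.norm_real, Real.norm_of_nonneg hx]
  have h := Complex.exp_bound' (x := (x : ℂ)) (n := m) (by
    rw [hn, div_le_iff₀ (by positivity)]; push_cast; linarith)
  rw [hn] at h
  have h2 : Complex.exp x - ∑ i ∈ range m, (x : ℂ) ^ i / i.factorial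
      = ((Real.exp x - ∑ i ∈ range m, x ^ i / i.factorial : ℝ) : ℂ) := by
    push_cast; rfl
  rw [h2, Complex.norm_real] at h
  linarith [(abs_le.1 h).2]

theorem centralRatio_three_mul_le_pow (n k : ℕ) :
    centralRatio n (3 * k) ≤
      centralRatio n (2 * k) * (((n - 2 * k) ^ k : ℕ) / ((n + 2 * k + 1) ^ k : ℕ)) := by
  rw [show 3 * k = 2 * k + k by ring, centralRatio_add]
  refine mul_le_mul_of_nonneg_left ?_ (centralRatio_nonneg _ _)
  calc _ ≤ ∏ _i ∈ range k, ((n - 2 * k : ℕ) : ℝ) / ((n : ℝ) + (2 * k : ℕ) + 1) := by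
        refine prod_le_prod (fun _ _ => by positivity) fun i _ => ?_
        have h1 : ((n - (2 * k + i) : ℕ) : ℝ) ≤ (n - 2 * k : ℕ) := by
          exact_mod_cast (by omega : n - (2 * k + i) ≤ n - 2 * k)
        gcongr
        omega
    _ = _ := by
        rw [prod_const, card_range, div_pow]
        push_cast
        rfl

/-- An integer test for `ρ(k) - ρ(2k) + ρ(3k) ≤ (c / d) exp (-k² / n)`, where
`ρ = centralRatio n`. -/
def upperCheck (n c d k : ℕ) : Bool :=
  Nat.ble
    (descProd n 0 k * (ascProd n k k * (n + 2 * k + 1) ^ k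
        - descProd n k k * ((n + 2 * k + 1) ^ k - (n - 2 * k) ^ k))
      * (expNum (k ^ 2) n 24 + (k ^ 2) ^ 24) * d)
    (c * (Nat.factorial 24 * n ^ 24) * ascProd n 0 k * ascProd n k k * (n + 2 * k + 1) ^ k)

/-- An integer test for `exp (-k² / n) < ρ(k) - ρ(2k)`, `ρ = centralRatio n`. -/
def lowerCheck (n k : ℕ) : Bool :=
  Nat.blt (Nat.factorial 22 * n ^ 22 * ascProd n 0 k * ascProd n k k)
    (descProd n 0 k * (ascProd n k k - descProd n k k) * expNum (k ^ 2) n 22)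

/-- `f i` holds for all `1 ≤ i ≤ K`. -/
def allUpTo (f : ℕ → Bool) (K : ℕ) : Bool := Nat.rec true (fun i ih => f (i + 1) && ih) K

theorem of_allUpTo {f : ℕ → Bool} {K : ℕ} (h : allUpTo f K = true) {i : ℕ} (h1 : 1 ≤ i)
    (hK : i ≤ K) : f i = true := by
  induction K with
  | zero => omega
  | succ K ih =>
    have h' : (f (K + 1) && allUpTo f K) = true := h
    rw [Bool.and_eq_true] at h'
    rcases Nat.lt_or_ge K i with hi | hi
    · obtain rfl : i = K + 1 := by omega
      exact h'.1
    · exact ih h'.2 hi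

theorem upper_of_upperCheck {n c d k : ℕ} (hn : 0 < n) (hd : 0 < d) (hk : k ^ 2 ≤ 12 * n)
    (h : upperCheck n c d k = true) :
    centralRatio n k - centralRatio n (2 * k) + centralRatio n (3 * k)
      ≤ (c / d : ℝ) * Real.exp (-((k : ℝ) ^ 2 / n)) := by
  have hn' : (0 : ℝ) < n := by exact_mod_cast hn
  have hd' : (0 : ℝ) < d := by exact_mod_cast hd
  have h2 := centralRatio_add_eq n k k
  have h3 := centralRatio_three_mul_le_pow n k
  rw [← two_mul] at h2
  rw [h2] at h3
  have h1 := centralRatio_eq_prods n k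
  have hA0 : (0 : ℝ) < ascProd n 0 k := by exact_mod_cast ascProd_pos n 0 k
  have hA1 : (0 : ℝ) < ascProd n k k := by exact_mod_cast ascProd_pos n k k
  have hle2 : (n - 2 * k) ^ k ≤ (n + 2 * k + 1) ^ k := Nat.pow_le_pow_left (by omega) k
  obtain ⟨r, hr⟩ : ∃ r, (n - 2 * k) ^ k = r := ⟨_, rfl⟩
  obtain ⟨s, hs⟩ : ∃ s, (n + 2 * k + 1) ^ k = s := ⟨_, rfl⟩
  have hA2 : (0 : ℝ) < s := by
    have : 0 < s := hs ▸ by positivity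
    exact_mod_cast this
  have hcheck := Nat.le_of_ble_eq_true h
  rw [hr, hs] at h3 hcheck hle2
  have hle1 := descProd_le_ascProd n k k
  have hmul : descProd n k k * (s - r)
      ≤ ascProd n k k * s :=
    Nat.mul_le_mul hle1 (Nat.sub_le _ _)
  have hx : (0 : ℝ) ≤ ((k ^ 2 : ℕ) : ℝ) / n := by positivity
  have hexp : Real.exp (((k ^ 2 : ℕ) : ℝ) / n) * ((Nat.factorial 24 : ℝ) * (n : ℝ) ^ 24)
      ≤ (expNum (k ^ 2) n 24 : ℝ) + ((k ^ 2 : ℕ) : ℝ) ^ 24 := by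
    have := exp_le_sum_add (m := 24) hx (by
      rw [← mul_div_assoc, div_le_iff₀ hn']
      have : ((k ^ 2 : ℕ) : ℝ) ≤ ((12 * n : ℕ) : ℝ) := by exact_mod_cast hk
      push_cast at this ⊢
      linarith)
    have hP : (0 : ℝ) < (Nat.factorial 24 : ℝ) * (n : ℝ) ^ 24 := by positivity
    refine (mul_le_mul_of_nonneg_right this hP.le).trans_eq ?_
    rw [expNum_eq _ _ _ hn, sum_range_succ _ 24, div_pow _ _ 24]
    have hf : (Nat.factorial 24 : ℝ) ≠ 0 := by positivity
    generalize (∑ i ∈ range 24, _ : ℝ) = s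
    generalize (Nat.factorial 24 : ℝ) = f at *
    field_simp
    ring
  have hcheck' := (Nat.cast_le (α := ℝ)).2 hcheck
  push_cast [Nat.cast_sub hle2, Nat.cast_sub hmul] at hcheck'
  push_cast at hexp
  rw [h1] at h2 h3
  rw [h2, h1, Real.exp_neg]
  set E := Real.exp ((k : ℝ) ^ 2 / n)
  have hE : 0 < E := Real.exp_pos _
  have hQ : (0 : ℝ) < (Nat.factorial 24 : ℝ) * (n : ℝ) ^ 24 := by positivity
  set Q : ℝ := (Nat.factorial 24 : ℝ) * (n : ℝ) ^ 24
  set W : ℝ := descProd n 0 k * (ascProd n k k * s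
        - descProd n k k * (s - r)) with hW
  have hW0 : 0 ≤ W := by
    have : ((descProd n k k * (s - r) : ℕ) : ℝ)
      ≤ ((ascProd n k k * s : ℕ) : ℝ) := by exact_mod_cast hmul
    push_cast [Nat.cast_sub hle2] at this
    exact mul_nonneg (Nat.cast_nonneg _) (sub_nonneg.2 this)
  have hfin : Q * (W * E * d) ≤
      Q * (c * (ascProd n 0 k * ascProd n k k * s)) := by
    have := mul_le_mul_of_nonneg_left hexp (mul_nonneg hW0 hd'.le)
    linarith
  have hfin' := le_of_mul_le_mul_left hfin hQ
  calc _ ≤ _ := add_le_add_right h3 _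
    _ = W / (ascProd n 0 k * ascProd n k k * s) := by
        rw [hW]; field_simp; ring
    _ ≤ (c / d : ℝ) * E⁻¹ := by
        rw [div_mul_eq_mul_div, ← div_eq_mul_inv, div_div, div_le_div_iff₀ (by positivity)
          (by positivity)]
        linarith

theorem lower_of_lowerCheck {n k : ℕ} (hn : 0 < n) (h : lowerCheck n k = true) :
    Real.exp (-((k : ℝ) ^ 2 / n)) < centralRatio n k - centralRatio n (2 * k) := by
  have hn' : (0 : ℝ) < n := by exact_mod_cast hn
  have h2 := centralRatio_add_eq n k k
  rw [← two_mul] at h2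
  have h1 := centralRatio_eq_prods n k
  have hA0 : (0 : ℝ) < ascProd n 0 k := by exact_mod_cast ascProd_pos n 0 k
  have hA1 : (0 : ℝ) < ascProd n k k := by exact_mod_cast ascProd_pos n k k
  have hle1 := descProd_le_ascProd n k k
  have hx : (0 : ℝ) ≤ ((k ^ 2 : ℕ) : ℝ) / n := by positivity
  have hP : (0 : ℝ) < (Nat.factorial 22 : ℝ) * (n : ℝ) ^ 22 := by positivity
  have hexp : (expNum (k ^ 2) n 22 : ℝ)
      ≤ ((Nat.factorial 22 : ℝ) * (n : ℝ) ^ 22) * Real.exp (((k ^ 2 : ℕ) : ℝ) / n) := by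
    rw [expNum_eq _ _ _ hn]
    exact mul_le_mul_of_nonneg_left (Real.sum_le_exp_of_nonneg hx _) hP.le
  have hcheck : Nat.factorial 22 * n ^ 22 * ascProd n 0 k * ascProd n k k <
    descProd n 0 k * (ascProd n k k - descProd n k k) * expNum (k ^ 2) n 22 :=
      Nat.le_of_ble_eq_true h
  have hcheck' := (Nat.cast_lt (α := ℝ)).2 hcheck
  push_cast [Nat.cast_sub hle1] at hcheck'
  push_cast at hexp
  rw [h2, h1, Real.exp_neg]
  have hE : 0 < Real.exp ((k : ℝ) ^ 2 / n) := Real.exp_pos _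
  set E := Real.exp ((k : ℝ) ^ 2 / n)
  set Q : ℝ := (Nat.factorial 22 : ℝ) * (n : ℝ) ^ 22
  set W : ℝ := descProd n 0 k * (ascProd n k k - descProd n k k) with hW
  have hW0 : 0 ≤ W :=
    mul_nonneg (Nat.cast_nonneg _) (sub_nonneg.2 (by exact_mod_cast hle1))
  have hfin : Q * (ascProd n 0 k * ascProd n k k) < Q * (W * E) := by
    have := mul_le_mul_of_nonneg_left hexp hW0
    linarith
  have hfin' := lt_of_mul_lt_mul_left hfin hP.le
  calc E⁻¹ < W / (ascProd n 0 k * ascProd n k k) := by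
        rw [inv_eq_one_div, div_lt_div_iff₀ hE (by positivity)]
        linarith
    _ = _ := by rw [hW]; field_simp

theorem sum_odd (k : ℕ) : ∑ i ∈ range k, (2 * (i : ℝ) + 1) = k ^ 2 := by
  induction k with
  | zero => simp
  | succ k ih => rw [sum_range_succ, ih]; push_cast; ring

theorem sum_odd_cube (k : ℕ) :
    ∑ i ∈ range k, (2 * (i : ℝ) + 1) ^ 3 = (k : ℝ) ^ 2 * (2 * k ^ 2 - 1) := by
  induction k with
  | zero => simp
  | succ k ih => rw [sum_range_succ, ih]; push_cast; ring

theorem sum_odd_pow_five (k : ℕ) :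
    ∑ i ∈ range k, (2 * (i : ℝ) + 1) ^ 5 = (k : ℝ) ^ 2 * (16 * k ^ 4 - 20 * k ^ 2 + 7) / 3 := by
  induction k with
  | zero => simp
  | succ k ih => rw [sum_range_succ, ih]; push_cast; ring

theorem one_sub_div_one_add {n i : ℕ} (hi : i ≤ n) :
    ((n - i : ℕ) : ℝ) / ((n : ℝ) + i + 1) =
      (1 - (2 * (i : ℝ) + 1) / (2 * n + 1)) / (1 + (2 * (i : ℝ) + 1) / (2 * n + 1)) := by
  have h1 : (0 : ℝ) < 2 * n + 1 := by positivity
  have h2 : (0 : ℝ) < (n : ℝ) + i + 1 := by positivity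
  have h3 : (0 : ℝ) < 1 + (2 * (i : ℝ) + 1) / (2 * n + 1) := by positivity
  rw [Nat.cast_sub hi, div_eq_div_iff h2.ne' h3.ne']
  field_simp
  ring

theorem factor_le_exp (n i : ℕ) :
    ((n - i : ℕ) : ℝ) / ((n : ℝ) + i + 1) ≤
      Real.exp (-2 * ((2 * (i : ℝ) + 1) / (2 * n + 1)
        + ((2 * (i : ℝ) + 1) / (2 * n + 1)) ^ 3 / 3)) := by
  rcases le_or_gt n i with h | h
  · rw [Nat.sub_eq_zero_of_le h]
    simpa using (Real.exp_pos _).le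
  · rw [one_sub_div_one_add h.le]
    have h' : (i : ℝ) + 1 ≤ n := by exact_mod_cast h
    set y : ℝ := (2 * (i : ℝ) + 1) / (2 * n + 1) with hy
    have hy0 : 0 ≤ y := by positivity
    have hy1 : y < 1 := by rw [hy, div_lt_one (by positivity)]; linarith
    have := Real.sum_range_le_log_div hy0 hy1 2
    rw [← Real.log_le_iff_le_exp (by apply div_pos <;> linarith), ← inv_div (1 + y), Real.log_inv]
    norm_num [sum_range_succ] at this
    linarith

theorem exp_le_factor {n i : ℕ} (h : i < n) :
    Real.exp (-2 * ((2 * (i : ℝ) + 1) / (2 * n + 1) + ((2 * (i : ℝ) + 1) / (2 * n + 1)) ^ 3 / 3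
      + ((2 * (i : ℝ) + 1) / (2 * n + 1)) ^ 5 / (1 - ((2 * (i : ℝ) + 1) / (2 * n + 1)) ^ 2)))
      ≤ ((n - i : ℕ) : ℝ) / ((n : ℝ) + i + 1) := by
  rw [one_sub_div_one_add h.le]
  have h' : (i : ℝ) + 1 ≤ n := by exact_mod_cast h
  set y : ℝ := (2 * (i : ℝ) + 1) / (2 * n + 1) with hy
  have hy0 : 0 ≤ y := by positivity
  have hy1 : y < 1 := by rw [hy, div_lt_one (by positivity)]; linarith
  have := Real.log_div_le_sum_range_add hy0 hy1 2
  rw [← Real.le_log_iff_exp_le (by apply div_pos <;> linarith), ← inv_div (1 + y), Real.log_inv]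
  norm_num [sum_range_succ] at this
  linarith

theorem centralRatio_le_exp (n k : ℕ) :
    centralRatio n k ≤ Real.exp (-2 * ((k : ℝ) ^ 2 / (2 * n + 1)
      + (k : ℝ) ^ 2 * (2 * k ^ 2 - 1) / (3 * (2 * n + 1) ^ 3))) := by
  refine (prod_le_prod (fun _ _ => by positivity) fun i _ => factor_le_exp n i).trans_eq ?_
  rw [← Real.exp_sum, ← mul_sum, sum_add_distrib, ← sum_div]
  simp_rw [div_pow]
  rw [← sum_div, ← sum_div, sum_odd_cube, sum_odd]
  congr 3
  field_simp

theorem exp_le_centralRatio {n k : ℕ} (h : k ≤ n) {t : ℝ} (ht : t < 1)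
    (hk : (2 * (k : ℝ) / (2 * n + 1)) ^ 2 ≤ t) :
    Real.exp (-2 * ((k : ℝ) ^ 2 / (2 * n + 1)
      + (k : ℝ) ^ 2 * (2 * k ^ 2 - 1) / (3 * (2 * n + 1) ^ 3)
      + 16 * (k : ℝ) ^ 6 / (3 * (2 * n + 1) ^ 5 * (1 - t)))) ≤ centralRatio n k := by
  have hN : (0 : ℝ) < 2 * n + 1 := by positivity
  have ht' : 0 < 1 - t := by linarith
  have h5 : ∑ i ∈ range k, (2 * (i : ℝ) + 1) ^ 5 ≤ 16 * (k : ℝ) ^ 6 / 3 := by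
    rw [sum_odd_pow_five]
    rcases Nat.eq_zero_or_pos k with rfl | hk0
    · simp
    · have : (1 : ℝ) ≤ k := by exact_mod_cast hk0
      have h2 : (0 : ℝ) ≤ (k : ℝ) ^ 2 * (20 * (k : ℝ) ^ 2 - 7) := by
        apply mul_nonneg (by positivity); nlinarith
      nlinarith
  have step : ∀ i ∈ range k, Real.exp (-2 * ((2 * (i : ℝ) + 1) / (2 * n + 1)
      + ((2 * (i : ℝ) + 1) / (2 * n + 1)) ^ 3 / 3
      + ((2 * (i : ℝ) + 1) / (2 * n + 1)) ^ 5 / (1 - t)))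
      ≤ ((n - i : ℕ) : ℝ) / ((n : ℝ) + i + 1) := by
    intro i hi
    have hik := mem_range.1 hi
    have hik' : (i : ℝ) + 1 ≤ k := by exact_mod_cast hik
    refine le_trans (Real.exp_le_exp.2 ?_) (exp_le_factor (hik.trans_le h))
    have hy : ((2 * (i : ℝ) + 1) / (2 * n + 1)) ^ 2 ≤ t := by
      refine le_trans (pow_le_pow_left₀ (by positivity) ?_ 2) hk
      gcongr; linarith
    have : ((2 * (i : ℝ) + 1) / (2 * n + 1)) ^ 5 / (1 - ((2 * (i : ℝ) + 1) / (2 * n + 1)) ^ 2)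
      ≤ ((2 * (i : ℝ) + 1) / (2 * n + 1)) ^ 5 / (1 - t) := by gcongr
    linarith
  refine le_trans ?_ (prod_le_prod (fun _ _ => (Real.exp_pos _).le) step)
  rw [← Real.exp_sum, ← mul_sum, sum_add_distrib, sum_add_distrib, ← sum_div]
  simp_rw [div_pow]
  rw [← sum_div, ← sum_div, ← sum_div, ← sum_div, sum_odd_cube, sum_odd, Real.exp_le_exp]
  have e1 : (∑ i ∈ range k, (2 * (i : ℝ) + 1) ^ 5) / (2 * n + 1) ^ 5 / (1 - t)
      ≤ 16 * (k : ℝ) ^ 6 / (3 * (2 * n + 1) ^ 5 * (1 - t)) := by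
    refine (div_le_div_of_nonneg_right (div_le_div_of_nonneg_right h5 (by positivity))
      ht'.le).trans_eq ?_
    field_simp
  have e2 : (k : ℝ) ^ 2 * (2 * k ^ 2 - 1) / (2 * n + 1) ^ 3 / 3
      = (k : ℝ) ^ 2 * (2 * k ^ 2 - 1) / (3 * (2 * n + 1) ^ 3) := by field_simp
  linarith

/-- Far in the tail a single binomial ratio is at most `exp (-k² / n)`. -/
theorem centralRatio_le_of_le_sq {n k : ℕ} (hn : 2 ≤ n) (hk : 3 * n + 4 ≤ k ^ 2) :
    centralRatio n k ≤ Real.exp (-((k : ℝ) ^ 2 / n)) := by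
  refine (centralRatio_le_exp n k).trans (Real.exp_le_exp.2 ?_)
  have hn' : (2 : ℝ) ≤ n := by exact_mod_cast hn
  have hk' : 3 * (n : ℝ) + 4 ≤ (k : ℝ) ^ 2 := by exact_mod_cast hk
  have h : 1 / (n : ℝ) ≤ 2 * (1 / (2 * n + 1) + (2 * (k : ℝ) ^ 2 - 1) / (3 * (2 * n + 1) ^ 3)) := by
    rw [div_add_div _ _ (by positivity) (by positivity), ← mul_div_assoc,
      div_le_div_iff₀ (by positivity) (by positivity)]
    have hN : (0 : ℝ) < 2 * n + 1 := by positivity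
    have : 3 * (2 * (n : ℝ) + 1) ^ 2 ≤ 2 * n * (2 * (k : ℝ) ^ 2 - 1) := by nlinarith
    nlinarith [mul_le_mul_of_nonneg_left this hN.le]
  have := mul_le_mul_of_nonneg_left h (sq_nonneg (k : ℝ))
  calc _ = -((k : ℝ) ^ 2 * (2 * (1 / (2 * n + 1)
          + (2 * (k : ℝ) ^ 2 - 1) / (3 * (2 * n + 1) ^ 3)))) := by ring
    _ ≤ -((k : ℝ) ^ 2 * (1 / n)) := neg_le_neg this
    _ = _ := by ring

theorem centralRatio_antitone (n : ℕ) : Antitone (centralRatio n) := by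
  refine antitone_nat_of_succ_le fun k => ?_
  rw [centralRatio, prod_range_succ, ← centralRatio]
  refine mul_le_of_le_one_right (centralRatio_nonneg n k) ?_
  rw [div_le_one (by positivity)]
  have : ((n - k : ℕ) : ℝ) ≤ n := by exact_mod_cast Nat.sub_le n k
  linarith [(k.cast_nonneg : (0 : ℝ) ≤ k)]

theorem centralRatio_three_mul_le (n k : ℕ) :
    centralRatio n (3 * k) ≤
      centralRatio n (2 * k) * Real.exp (-(10 * (k : ℝ) ^ 2 / (2 * n + 1))) := by
  rw [show 3 * k = 2 * k + k by ring, centralRatio_add]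
  refine mul_le_mul_of_nonneg_left ?_ (centralRatio_nonneg _ _)
  refine (prod_le_prod (fun _ _ => by positivity) fun i _ => factor_le_exp n (2 * k + i)).trans ?_
  rw [← Real.exp_sum, ← mul_sum, Real.exp_le_exp]
  have h1 : ∑ i ∈ range k, (2 * ((2 * k + i : ℕ) : ℝ) + 1) / (2 * n + 1)
      ≤ ∑ i ∈ range k, ((2 * ((2 * k + i : ℕ) : ℝ) + 1) / (2 * n + 1)
        + ((2 * ((2 * k + i : ℕ) : ℝ) + 1) / (2 * n + 1)) ^ 3 / 3) :=
    sum_le_sum fun i _ => le_add_of_nonneg_right (by positivity)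
  have h2 : ∑ i ∈ range k, (2 * ((2 * k + i : ℕ) : ℝ) + 1) / (2 * n + 1)
      = 5 * (k : ℝ) ^ 2 / (2 * n + 1) := by
    rw [← sum_div]
    congr 1
    calc ∑ i ∈ range k, (2 * ((2 * k + i : ℕ) : ℝ) + 1)
        = ∑ i ∈ range k, (4 * (k : ℝ) + (2 * (i : ℝ) + 1)) :=
          sum_congr rfl fun i _ => by push_cast; ring
      _ = _ := by rw [sum_add_distrib, sum_odd]; simp; ring
  have h3 : 10 * (k : ℝ) ^ 2 / (2 * n + 1) = 2 * (5 * (k : ℝ) ^ 2 / (2 * n + 1)) := by ring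
  rw [h3]
  linarith

theorem exp_tangent_point_le : Real.exp (81 / 10) ≤ 3296 := by
  have h : Real.exp (81 / 10) ^ 10 = Real.exp 1 ^ 81 := by
    rw [← Real.exp_nat_mul, ← Real.exp_nat_mul]; norm_num
  have h2 : Real.exp 1 ^ 81 ≤ 3296 ^ 10 :=
    (pow_le_pow_left₀ (Real.exp_pos 1).le Real.exp_one_lt_d9.le 81).trans (by norm_num)
  exact le_of_pow_le_pow_left₀ (by norm_num) (by norm_num) (h.trans_le h2)

/-- The one-variable inequality behind the constant `2` for large samples. -/
theorem large_sample_ineq {N w : ℝ} (hN : 1001 ≤ N) (hw : 0 < w) (hw3 : w ≤ 3.005)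
    {α ε : ℝ} (hα : α = w / (N - 1) - w * (w - 1 / N) / (3 * N)) (hε : ε ≤ 0.0505) :
    Real.exp α - 1 ≤ Real.exp (-3 * w - ε) * (1 - Real.exp (-5 * w)) := by
  have hrhs : 0 ≤ Real.exp (-3 * w - ε) * (1 - Real.exp (-5 * w)) :=
    mul_nonneg (Real.exp_pos _).le (sub_nonneg.2 (Real.exp_le_one_iff.2 (by linarith)))
  rcases le_or_gt α 0 with h0 | h0
  · have := Real.exp_le_one_iff.2 h0
    linarith
  have hNα : N * α ≤ w * (1.0014 - w / 3) := by
    have e1 : N * α = w * (1 + 1 / (N - 1) - w / 3 + 1 / (3 * N)) := by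
      rw [hα]; have : N - 1 ≠ 0 := by linarith
      field_simp; ring
    rw [e1]
    refine mul_le_mul_of_nonneg_left ?_ hw.le
    have h1 : 1 / (N - 1) ≤ 1 / 1000 := by gcongr; linarith
    have h2 : 1 / (3 * N) ≤ 1 / 3000 := by gcongr; linarith
    linarith
  have hα1 : α ≤ 0.0031 := by
    have : 1001 * α ≤ N * α := by gcongr
    nlinarith
  have hexp : Real.exp α - 1 ≤ 1.0031 * α := by
    have := (abs_le.1 (Real.abs_exp_sub_one_sub_id_le (x := α) (by rw [abs_of_pos h0]; linarith))).2
    nlinarith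
  have hlhs : N * (Real.exp α - 1) ≤ 1.0031 * (w * (1.0014 - w / 3)) := by nlinarith
  have hε' : (0.9495 : ℝ) ≤ Real.exp (-ε) := by
    have := Real.add_one_le_exp (-ε); linarith
  have hsplit : Real.exp (-3 * w - ε) = Real.exp (-3 * w) * Real.exp (-ε) := by
    rw [← Real.exp_add]; ring_nf
  suffices h : 1.0031 * (w * (1.0014 - w / 3)) ≤
      1001 * (Real.exp (-3 * w) * 0.9495 * (1 - Real.exp (-5 * w))) by
    have hpos : 0 ≤ 1 - Real.exp (-5 * w) := sub_nonneg.2 (Real.exp_le_one_iff.2 (by linarith))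
    have hmono : Real.exp (-3 * w) * 0.9495 * (1 - Real.exp (-5 * w)) ≤
        Real.exp (-3 * w - ε) * (1 - Real.exp (-5 * w)) := by
      rw [hsplit]
      gcongr
    have hN0 : 0 < N := by linarith
    refine le_of_mul_le_mul_left (hlhs.trans (h.trans ?_)) hN0
    gcongr
  rcases le_or_gt w 1 with hw1 | hw1
  · have h1 : (0.03 : ℝ) ≤ Real.exp (-3 * w) := by
      refine le_trans ?_ (Real.exp_le_exp.2 (show -3 ≤ -3 * w by linarith))
      rw [Real.exp_neg, show (3 : ℝ) = ((3 : ℕ) : ℝ) * 1 by norm_num, Real.exp_nat_mul]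
      rw [← one_div, le_div_iff₀ (by positivity)]
      have := pow_le_pow_left₀ (Real.exp_pos 1).le Real.exp_one_lt_d9.le 3
      nlinarith
    have h2 : 5 * w / 6 ≤ 1 - Real.exp (-5 * w) := by
      have h3 : Real.exp (-5 * w) ≤ 1 / (1 + 5 * w) := by
        rw [show -5 * w = -(5 * w) by ring, Real.exp_neg, ← one_div]
        gcongr
        linarith [Real.add_one_le_exp (5 * w)]
      have h4 : 1 / (1 + 5 * w) ≤ 1 - 5 * w / 6 := by
        rw [div_le_iff₀ (by linarith)]; nlinarith
      linarith
    have h5 : 0.03 * 0.9495 * (5 * w / 6) ≤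
        Real.exp (-3 * w) * 0.9495 * (1 - Real.exp (-5 * w)) := by gcongr
    nlinarith
  · have h1 : Real.exp (-5 * w) ≤ 1 / 128 := by
      refine (Real.exp_le_exp.2 (show -5 * w ≤ -5 by linarith)).trans ?_
      rw [Real.exp_neg, show (5 : ℝ) = ((5 : ℕ) : ℝ) * 1 by norm_num, Real.exp_nat_mul, ← one_div]
      gcongr
      refine le_trans ?_ (pow_le_pow_left₀ (by norm_num) Real.exp_one_gt_d9.le 5)
      norm_num
    have h2 : 1 / 3296 * (9.1 - 3 * w) ≤ Real.exp (-3 * w) := by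
      have e : Real.exp (-3 * w) = Real.exp (-(81 / 10)) * Real.exp (8.1 - 3 * w) := by
        rw [← Real.exp_add]; ring_nf
      rw [e]
      have h3 : (1 : ℝ) / 3296 ≤ Real.exp (-(81 / 10)) := by
        rw [Real.exp_neg, ← one_div]
        gcongr
        exact exp_tangent_point_le
      have := Real.add_one_le_exp (8.1 - 3 * w)
      apply mul_le_mul h3 (by linarith) (by norm_num at *; linarith) (Real.exp_pos _).le
    have h5 : 1 / 3296 * (9.1 - 3 * w) * 0.9495 * (127 / 128) ≤
        Real.exp (-3 * w) * 0.9495 * (1 - Real.exp (-5 * w)) := by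
      gcongr; linarith
    nlinarith [sq_nonneg (w - 2.7)]

/-- For `n ≥ 500` the three-term bound is at most `exp (-k² / n)`. -/
theorem three_term_le_of_large {n k : ℕ} (hn : 500 ≤ n) (hk1 : 1 ≤ k) (hk : k ^ 2 ≤ 3 * n + 4) :
    centralRatio n k - centralRatio n (2 * k) + centralRatio n (3 * k)
      ≤ Real.exp (-((k : ℝ) ^ 2 / n)) := by
  have hn' : (500 : ℝ) ≤ n := by exact_mod_cast hn
  have hk1' : (1 : ℝ) ≤ k := by exact_mod_cast hk1
  have hk' : (k : ℝ) ^ 2 ≤ 3 * n + 4 := by exact_mod_cast hk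
  have h2k : 2 * k ≤ n := by nlinarith
  set N : ℝ := 2 * n + 1 with hN
  have hN1 : 1001 ≤ N := by linarith
  set w : ℝ := 2 * (k : ℝ) ^ 2 / N with hw
  have hw0 : 0 < w := by positivity
  have hw3 : w ≤ 3.005 := by
    rw [hw, div_le_iff₀ (by linarith)]; linarith
  have hkw : (k : ℝ) ^ 2 = w * N / 2 := by rw [hw]; field_simp
  have hv : (k : ℝ) ^ 2 / n = w + w / (N - 1) := by
    have : (n : ℝ) ≠ 0 := by linarith
    rw [hw, hN]; field_simp; ring
  set α : ℝ := w / (N - 1) - w * (w - 1 / N) / (3 * N) with hα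
  set ε : ℝ := 16 * w ^ 2 / (3 * N) + 88 * w ^ 3 / N ^ 2 with hε
  have hε' : ε ≤ 0.0505 := by
    have h1 : 16 * w ^ 2 / (3 * N) ≤ 16 * 3.005 ^ 2 / (3 * 1001) := by gcongr
    have h2 : 88 * w ^ 3 / N ^ 2 ≤ 88 * 3.005 ^ 3 / 1001 ^ 2 := by gcongr
    norm_num at h1 h2 ⊢
    linarith
  have hfirst : centralRatio n k ≤ Real.exp (-((k : ℝ) ^ 2 / n)) * Real.exp α := by
    refine (centralRatio_le_exp n k).trans ?_
    rw [← Real.exp_add, Real.exp_le_exp, hv, hkw, ← hN, hα]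
    apply le_of_eq
    have : N - 1 ≠ 0 := by linarith
    field_simp
    ring
  have hsecond : Real.exp (-((k : ℝ) ^ 2 / n)) * Real.exp (-3 * w - ε) ≤
      centralRatio n (2 * k) := by
    refine le_trans ?_ (exp_le_centralRatio (n := n) (t := 1 / 33) h2k (by norm_num) ?_)
    · rw [← Real.exp_add, Real.exp_le_exp, hv, ← hN]
      have e1 : (((2 * k : ℕ) : ℝ)) ^ 2 = 2 * w * N := by push_cast; rw [mul_pow, hkw]; ring
      have e2 : (((2 * k : ℕ) : ℝ)) ^ 6 = (2 * w * N) ^ 3 := by rw [← e1]; ring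
      rw [e2, e1]
      have e3 : -2 * (2 * w * N / N + 2 * w * N * (2 * (2 * w * N) - 1) / (3 * N ^ 3)
          + 16 * (2 * w * N) ^ 3 / (3 * N ^ 5 * (1 - 1 / 33)))
          = -4 * w - 16 * w ^ 2 / (3 * N) + 4 * w / (3 * N ^ 2) - 88 * w ^ 3 / N ^ 2 := by
        field_simp
        ring
      rw [e3, hε]
      have : 0 ≤ 4 * w / (3 * N ^ 2) := by positivity
      have : 0 ≤ w / (N - 1) := div_nonneg hw0.le (by linarith)
      linarith
    · push_cast
      rw [← hN, div_pow, div_le_iff₀ (by positivity)]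
      nlinarith
  have hthird := centralRatio_three_mul_le n k
  rw [show -(10 * (k : ℝ) ^ 2 / (2 * n + 1)) = -5 * w by rw [hw]; ring] at hthird
  have hineq := large_sample_ineq hN1 hw0 hw3 hα hε'
  have hE := Real.exp_pos (-((k : ℝ) ^ 2 / n))
  set E := Real.exp (-((k : ℝ) ^ 2 / n))
  have hpos : 0 ≤ 1 - Real.exp (-5 * w) := sub_nonneg.2 (Real.exp_le_one_iff.2 (by linarith))
  have h1 := mul_le_mul_of_nonneg_right hsecond hpos
  have h2 := mul_le_mul_of_nonneg_left hineq hE.le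
  linarith

/-- The three-term bound with constant `c` for the sample size `n`. -/
def ThreeTermLe (n : ℕ) (c : ℝ) : Prop :=
  ∀ k : ℕ, 1 ≤ k → centralRatio n k - centralRatio n (2 * k) + centralRatio n (3 * k)
    ≤ c * Real.exp (-((k : ℝ) ^ 2 / n))

theorem three_term_le_first (n k : ℕ) :
    centralRatio n k - centralRatio n (2 * k) + centralRatio n (3 * k) ≤ centralRatio n k := by
  have : centralRatio n (3 * k) ≤ centralRatio n (2 * k) :=
    centralRatio_antitone n (by omega)
  linarith

/-- All the tests for the constant `c / d` and the sample size `n`. -/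
def upperChecks (n c d : ℕ) : Bool := allUpTo (upperCheck n c d) (Nat.sqrt (3 * n + 4))

theorem threeTermLe_of_upperChecks {n c d : ℕ} (hn : 2 ≤ n) (hd : 0 < d) (hcd : d ≤ c)
    (h : upperChecks n c d = true) : ThreeTermLe n (c / d) := by
  intro k hk1
  rcases le_total (3 * n + 4) (k ^ 2) with hk | hk
  · have h1 : (1 : ℝ) ≤ c / d := by
      rw [one_le_div (by exact_mod_cast hd)]
      exact_mod_cast hcd
    exact (three_term_le_first n k).trans ((centralRatio_le_of_le_sq hn hk).trans
      (le_mul_of_one_le_left (Real.exp_pos _).le h1))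
  · refine upper_of_upperCheck (by omega) hd (by omega) (of_allUpTo h hk1 ?_)
    rwa [Nat.le_sqrt']

theorem threeTermLe_of_large {n : ℕ} (hn : 500 ≤ n) : ThreeTermLe n 1 := by
  intro k hk1
  rw [one_mul]
  rcases le_total (3 * n + 4) (k ^ 2) with hk | hk
  · exact (three_term_le_first n k).trans (centralRatio_le_of_le_sq (by omega) hk)
  · exact three_term_le_of_large hn hk1 hk

theorem ThreeTermLe.mono {n : ℕ} {c c' : ℝ} (h : ThreeTermLe n c) (hc : c ≤ c') :
    ThreeTermLe n c' := fun k hk =>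
  (h k hk).trans (mul_le_mul_of_nonneg_right hc (Real.exp_pos _).le)

/-- The tests with constant `1` for the sample sizes `458, …, 499`. -/
theorem upperChecks_one :
    allUpTo (fun i => upperChecks (457 + i) 1 1) 42 = true := by decide +kernel

/-- The tests for the relative excess `-7 / (100 n) + 40 / n² - 400 / n³ - 10⁻⁶`. -/
def excessChecks (n : ℕ) : Bool :=
  upperChecks n (10 ^ 4 * (100 * n ^ 3 + 4000 * n - 40000 - 7 * n ^ 2) - n ^ 3) (10 ^ 6 * n ^ 3)

theorem excessChecks_first : allUpTo (fun i => excessChecks (11 + i)) 139 = true := by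
  decide +kernel

theorem excessChecks_second : allUpTo (fun i => excessChecks (150 + i)) 110 = true := by
  decide +kernel

theorem excessChecks_third : allUpTo (fun i => excessChecks (260 + i)) 100 = true := by
  decide +kernel

theorem excessChecks_fourth : allUpTo (fun i => excessChecks (360 + i)) 97 = true := by
  decide +kernel

theorem excessChecks_true {n : ℕ} (h1 : 12 ≤ n) (h2 : n < 458) : excessChecks n = true := by
  have key : ∀ a b : ℕ, allUpTo (fun i => excessChecks (a + i)) b = true → a < n → n ≤ a + b →
      excessChecks n = true := by
    intro a b h ha hb
    have := of_allUpTo h (i := n - a) (by omega) (by omega)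
    rwa [show a + (n - a) = n by omega] at this
  rcases le_or_gt n 150 with h | h
  · exact key _ _ excessChecks_first (by omega) (by omega)
  rcases le_or_gt n 260 with h | h
  · exact key _ _ excessChecks_second (by omega) (by omega)
  rcases le_or_gt n 360 with h | h
  · exact key _ _ excessChecks_third (by omega) (by omega)
  · exact key _ _ excessChecks_fourth (by omega) (by omega)

/-- The tests for the constant `2.16863 / 2` and `4 ≤ n ≤ 11`. -/
theorem upperChecks_small :
    allUpTo (fun i => upperChecks (3 + i) 216863 200000) 8 = true := by decide +kernel

theorem upperChecks_two_three :
    allUpTo (fun i => upperChecks (1 + i) 5 4) 2 = true := by decide +kernel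

theorem lowerChecks :
    allUpTo (fun n => lowerCheck n (Nat.sqrt (27 * n / 10))
      || lowerCheck n (Nat.sqrt (27 * n / 10) + 1)) 457 = true := by
  decide +kernel

/-- The relative excess over the constant `2` for `12 ≤ n ≤ 457`. -/
noncomputable def excess (n : ℕ) : ℝ :=
  -(0.07 / (n : ℝ)) + 40 / (n : ℝ) ^ 2 - 400 / (n : ℝ) ^ 3 - 1 / 10 ^ 6

theorem excess_pos {n : ℕ} (h1 : 12 ≤ n) (h2 : n < 458) : 0 < excess n := by
  have hn : (12 : ℝ) ≤ n := by exact_mod_cast h1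
  have hn2 : (n : ℝ) ≤ 457 := by exact_mod_cast (by omega : n ≤ 457)
  have e : excess n = (-(70000 * (n : ℝ) ^ 2) + 40000000 * n - 400000000 - (n : ℝ) ^ 3)
      / (10 ^ 6 * (n : ℝ) ^ 3) := by
    unfold excess; field_simp; ring
  rw [e]
  apply div_pos _ (by positivity)
  nlinarith [mul_nonneg (sub_nonneg.2 hn) (sub_nonneg.2 hn2),
    mul_nonneg (mul_nonneg (sub_nonneg.2 hn) (sub_nonneg.2 hn2)) (by linarith : (0 : ℝ) ≤ n)]

theorem excess_le {n : ℕ} (h1 : 12 ≤ n) : excess n ≤ 0.084315 := by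
  have hn : (12 : ℝ) ≤ n := by exact_mod_cast h1
  have h : 40 / (n : ℝ) ^ 2 - 400 / (n : ℝ) ^ 3 ≤ 0.084315 := by
    have hp : (0 : ℝ) < n := by linarith
    rw [show 40 / (n : ℝ) ^ 2 - 400 / (n : ℝ) ^ 3 = (40 * n - 400) / (n : ℝ) ^ 3 by field_simp,
      div_le_iff₀ (by positivity)]
    nlinarith [sq_nonneg ((n : ℝ) - 15), mul_nonneg hp.le (sq_nonneg ((n : ℝ) - 15))]
  have : 0 ≤ 0.07 / (n : ℝ) := by positivity
  unfold excess
  linarith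

theorem threeTermLe_excess {n : ℕ} (h1 : 12 ≤ n) (h2 : n < 458) :
    ThreeTermLe n (1 + excess n) := by
  have hsub1 : 7 * n ^ 2 ≤ 100 * n ^ 3 + 4000 * n - 40000 := by
    have : n ^ 3 = n * n ^ 2 := by ring
    have : 12 * n ^ 2 ≤ n * n ^ 2 := Nat.mul_le_mul_right _ h1
    omega
  have hle : 10 ^ 6 * n ^ 3 ≤
      10 ^ 4 * (100 * n ^ 3 + 4000 * n - 40000 - 7 * n ^ 2) - n ^ 3 := by
    have hp := excess_pos h1 h2
    have hn : (12 : ℝ) ≤ n := by exact_mod_cast h1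
    have e : excess n = (-(70000 * (n : ℝ) ^ 2) + 40000000 * n - 400000000 - (n : ℝ) ^ 3)
        / (10 ^ 6 * (n : ℝ) ^ 3) := by
      unfold excess; field_simp; ring
    rw [e] at hp
    have := (div_pos_iff_of_pos_right (by positivity)).1 hp
    have h' : 70000 * n ^ 2 + 400000000 + n ^ 3 < 40000000 * n := by
      refine (Nat.cast_lt (α := ℝ)).1 ?_
      push_cast
      linarith
    obtain ⟨m, hm⟩ : ∃ m, 100 * n ^ 3 + 4000 * n = m + 7 * n ^ 2 + 40000 :=
      ⟨100 * n ^ 3 + 4000 * n - 40000 - 7 * n ^ 2, by omega⟩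
    rw [hm, Nat.add_sub_cancel, Nat.add_sub_cancel]
    apply Nat.le_sub_of_add_le
    linarith
  have h := threeTermLe_of_upperChecks (by omega) (by positivity) hle (excessChecks_true h1 h2)
  refine h.mono (le_of_eq ?_)
  have hn : (0 : ℝ) < n := by exact_mod_cast (by omega : 0 < n)
  rw [Nat.cast_sub (by omega), Nat.cast_mul, Nat.cast_sub hsub1, Nat.cast_sub (by omega), excess]
  push_cast
  field_simp
  ring

theorem threeTermLe_one {n : ℕ} (hn : 458 ≤ n) : ThreeTermLe n 1 := by
  rcases le_or_gt 500 n with h | h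
  · exact threeTermLe_of_large h
  · have h1 := of_allUpTo upperChecks_one (i := n - 457) (by omega) (by omega)
    rw [show 457 + (n - 457) = n by omega] at h1
    simpa using threeTermLe_of_upperChecks (by omega) one_pos le_rfl h1

theorem threeTermLe_of_four_le {n : ℕ} (hn : 4 ≤ n) : ThreeTermLe n (2.16863 / 2) := by
  rcases le_or_gt 458 n with h | h
  · exact (threeTermLe_one h).mono (by norm_num)
  rcases le_or_gt 12 n with h' | h'
  · exact (threeTermLe_excess h' h).mono (by linarith [excess_le h'])
  · have h1 := of_allUpTo upperChecks_small (i := n - 3) (by omega) (by omega)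
    rw [show 3 + (n - 3) = n by omega] at h1
    refine (threeTermLe_of_upperChecks (by omega) (by norm_num) (by norm_num) h1).mono ?_
    norm_num

theorem threeTermLe_exp_one {n : ℕ} (hn : 1 ≤ n) : ThreeTermLe n (Real.exp 1 / 2) := by
  have he := Real.exp_one_gt_d9
  rcases le_or_gt 4 n with h | h
  · exact (threeTermLe_of_four_le h).mono (by linarith)
  rcases le_or_gt 2 n with h' | h'
  · have h1 := of_allUpTo upperChecks_two_three (i := n - 1) (by omega) (by omega)
    rw [show 1 + (n - 1) = n by omega] at h1
    refine (threeTermLe_of_upperChecks h' (by norm_num) (by norm_num) h1).mono ?_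
    push_cast
    linarith
  · obtain rfl : n = 1 := by omega
    intro k hk
    rcases Nat.lt_or_ge 1 k with hk2 | hk2
    · refine (three_term_le_first 1 k).trans (le_trans (le_of_eq ?_)
        (mul_nonneg (by positivity) (Real.exp_pos _).le))
      exact prod_eq_zero (mem_range.2 hk2) (by simp)
    · obtain rfl : k = 1 := by omega
      refine (three_term_le_first 1 1).trans ?_
      rw [div_mul_eq_mul_div, ← Real.exp_add]
      norm_num [centralRatio]

theorem exists_exp_lt {n : ℕ} (h1 : 1 ≤ n) (h2 : n < 458) :
    ∃ k : ℕ, 1 ≤ k ∧ k ≤ n ∧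
      Real.exp (-((k : ℝ) ^ 2 / n)) < centralRatio n k - centralRatio n (2 * k) := by
  have h := of_allUpTo lowerChecks h1 (by omega)
  have key : ∀ k, 1 ≤ k → lowerCheck n k = true → ∃ k : ℕ, 1 ≤ k ∧ k ≤ n ∧
      Real.exp (-((k : ℝ) ^ 2 / n)) < centralRatio n k - centralRatio n (2 * k) := by
    intro k hk hc
    have hlt := lower_of_lowerCheck h1 hc
    refine ⟨k, hk, ?_, hlt⟩
    by_contra hkn
    have h0 : centralRatio n k = 0 :=
      prod_eq_zero (mem_range.2 (not_le.1 hkn)) (by simp)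
    have := Real.exp_pos (-((k : ℝ) ^ 2 / n))
    have := centralRatio_nonneg n (2 * k)
    linarith
  have hs : 1 ≤ Nat.sqrt (27 * n / 10) := by rw [Nat.le_sqrt]; omega
  rcases Bool.or_eq_true _ _ ▸ h with h | h
  · exact key _ hs h
  · exact key _ (by omega) h

/-- The binomial coefficient with an integer lower index, zero for negative ones. -/
def zchoose (N : ℕ) : ℤ → ℤ
  | .ofNat i => N.choose i
  | .negSucc _ => 0

theorem zchoose_natCast (N i : ℕ) : zchoose N (i : ℤ) = N.choose i := rfl

theorem zchoose_of_neg {N : ℕ} {x : ℤ} (hx : x < 0) : zchoose N x = 0 := by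
  cases x with
  | ofNat i => exact absurd hx (by simp)
  | negSucc i => rfl

theorem zchoose_nonneg (N : ℕ) (x : ℤ) : 0 ≤ zchoose N x := by
  cases x with
  | ofNat i => exact Int.natCast_nonneg _
  | negSucc i => exact le_rfl

theorem zchoose_succ (N : ℕ) (x : ℤ) :
    zchoose (N + 1) x = zchoose N x + zchoose N (x - 1) := by
  rcases lt_trichotomy x 0 with h | rfl | h
  · simp [zchoose_of_neg h, zchoose_of_neg (show x - 1 < 0 by omega)]
  · rw [zchoose_of_neg (show (0 : ℤ) - 1 < 0 by omega), ← Nat.cast_zero, zchoose_natCast,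
      zchoose_natCast]
    simp
  · obtain ⟨i, rfl⟩ : ∃ i : ℕ, x = i + 1 := ⟨(x - 1).toNat, by omega⟩
    rw [add_sub_cancel_right, ← Nat.cast_succ, zchoose_natCast, zchoose_natCast, zchoose_natCast,
      Nat.succ_eq_add_one, Nat.choose_succ_succ']
    push_cast
    ring

theorem zchoose_symm (N : ℕ) (x : ℤ) : zchoose N (N - x) = zchoose N x := by
  rcases lt_or_ge x 0 with h | h
  · obtain ⟨i, hi⟩ : ∃ i : ℕ, N - x = i := ⟨(N - x).toNat, by omega⟩
    rw [zchoose_of_neg h, hi, zchoose_natCast, Nat.choose_eq_zero_of_lt (by omega), Nat.cast_zero]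
  · obtain ⟨i, rfl⟩ : ∃ i : ℕ, x = i := ⟨x.toNat, by omega⟩
    rcases le_or_gt i N with hi | hi
    · rw [← Nat.cast_sub hi, zchoose_natCast, zchoose_natCast, Nat.choose_symm hi]
    · rw [zchoose_of_neg (by omega), zchoose_natCast, Nat.choose_eq_zero_of_lt hi, Nat.cast_zero]

theorem zchoose_zero_of_ne {x : ℤ} (hx : x ≠ 0) : zchoose 0 x = 0 := by
  rcases lt_or_ge x 0 with h | h
  · exact zchoose_of_neg h
  · obtain ⟨i, rfl⟩ : ∃ i : ℕ, x = i := ⟨x.toNat, by omega⟩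
    rw [zchoose_natCast, Nat.choose_eq_zero_of_lt (by omega), Nat.cast_zero]

/-- The subset `S` of `{0, …, N - 1}` has `a` elements, and its walk (up at the elements of `S`,
down elsewhere) stays strictly between `-k` and `k` up to time `N`. -/
def StaysInside (k N : ℕ) (a : ℤ) (S : Finset ℕ) : Prop :=
  (#S : ℤ) = a ∧ ∀ i ≤ N, |2 * (#{x ∈ S | x < i} : ℤ) - i| < k

open Classical in
/-- The number of walks of length `N` with `a` up-steps staying strictly between `-k` and `k`. -/
noncomputable def stayCount (k N : ℕ) (a : ℤ) : ℤ :=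
  ∑ S ∈ (range N).powerset, if StaysInside k N a S then 1 else 0

theorem filter_lt_eq_self {N M : ℕ} {S : Finset ℕ} (hS : S ⊆ range N) (h : N ≤ M) :
    {x ∈ S | x < M} = S :=
  filter_true_of_mem fun _ hx => (mem_range.1 (hS hx)).trans_le h

theorem stayCount_eq_zero {k N : ℕ} {a : ℤ} (h : (k : ℤ) ≤ |2 * a - N|) : stayCount k N a = 0 := by
  refine sum_eq_zero fun S hS => if_neg fun hin => ?_
  have h1 := hin.2 N le_rfl
  rw [filter_lt_eq_self (mem_powerset.1 hS) le_rfl, hin.1] at h1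
  omega

theorem stayCount_succ {k N : ℕ} {a : ℤ} (h : |2 * a - (N + 1 : ℕ)| < k) :
    stayCount k (N + 1) a = stayCount k N a + stayCount k N (a - 1) := by
  classical
  unfold stayCount
  rw [range_add_one, sum_powerset_insert notMem_range_self]
  congr 1
  · refine sum_congr rfl fun S hS => if_congr ?_ rfl rfl
    have hS' := mem_powerset.1 hS
    refine and_congr_right fun ha => ⟨fun hi i hiN => hi i (by omega), fun hi i hiN => ?_⟩
    rcases Nat.lt_or_ge N i with hlt | hle
    · obtain rfl : i = N + 1 := by omega
      rw [filter_lt_eq_self hS' (Nat.le_succ N), ha]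
      exact h
    · exact hi i hle
  · refine sum_congr rfl fun S hS => if_congr ?_ rfl rfl
    have hS' := mem_powerset.1 hS
    have hN : N ∉ S := fun hmem => by simpa using hS' hmem
    have hcard : #(insert N S) = #S + 1 := card_insert_of_notMem hN
    have hlow : ∀ i ≤ N, {x ∈ insert N S | x < i} = {x ∈ S | x < i} := fun i hi => by
      rw [filter_insert, if_neg (by omega)]
    constructor
    · rintro ⟨ha, hi⟩
      refine ⟨by rw [hcard] at ha; push_cast at ha; omega, fun i hiN => ?_⟩
      rw [← hlow i hiN]
      exact hi i (by omega)
    · rintro ⟨ha, hi⟩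
      have ha' : (#(insert N S) : ℤ) = a := by rw [hcard]; push_cast; omega
      refine ⟨ha', fun i hiN => ?_⟩
      rcases Nat.lt_or_ge N i with hlt | hle
      · obtain rfl : i = N + 1 := by omega
        rw [filter_true_of_mem, ha']
        · exact h
        · intro x hx
          rcases mem_insert.1 hx with rfl | hx
          · omega
          · have := mem_range.1 (hS' hx)
            omega
      · rw [hlow i hle]
        exact hi i hle

/-- The alternating sum of the images of order at most `2`. -/
def imagesTwo (k N : ℕ) (a : ℤ) : ℤ :=
  zchoose N a - zchoose N (a + k) - zchoose N (a - k) + zchoose N (a + 2 * k)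
    + zchoose N (a - 2 * k)

/-- The alternating sum of the images of order at most `3`. -/
def imagesThree (k N : ℕ) (a : ℤ) : ℤ :=
  imagesTwo k N a - zchoose N (a + 3 * k) - zchoose N (a - 3 * k)

theorem imagesTwo_succ (k N : ℕ) (a : ℤ) :
    imagesTwo k (N + 1) a = imagesTwo k N a + imagesTwo k N (a - 1) := by
  unfold imagesTwo
  simp only [zchoose_succ]
  ring_nf

theorem imagesThree_succ (k N : ℕ) (a : ℤ) :
    imagesThree k (N + 1) a = imagesThree k N a + imagesThree k N (a - 1) := by
  unfold imagesThree
  rw [imagesTwo_succ]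
  simp only [zchoose_succ]
  ring_nf

theorem images_boundary {k N : ℕ} {a : ℤ} (h : |2 * a - N| = k) :
    0 ≤ imagesTwo k N a ∧ imagesThree k N a ≤ 0 := by
  have s0 := zchoose_symm N a
  have s1 := zchoose_symm N (a + k)
  have s2 := zchoose_symm N (a - k)
  have s3 := zchoose_symm N (a + 2 * k)
  have s4 := zchoose_symm N (a - 2 * k)
  have p1 := zchoose_nonneg N (a + 2 * k)
  have p2 := zchoose_nonneg N (a - 2 * k)
  have p3 := zchoose_nonneg N (a + 3 * k)
  have p4 := zchoose_nonneg N (a - 3 * k)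
  unfold imagesThree imagesTwo
  rcases abs_eq (Int.natCast_nonneg k) |>.1 h with h | h
  · rw [show (N : ℤ) - a = a - k by omega] at s0
    rw [show (N : ℤ) - (a + k) = a - 2 * k by omega] at s1
    rw [show (N : ℤ) - (a + 2 * k) = a - 3 * k by omega] at s3
    constructor <;> omega
  · rw [show (N : ℤ) - a = a + k by omega] at s0
    rw [show (N : ℤ) - (a - k) = a + 2 * k by omega] at s2
    rw [show (N : ℤ) - (a - 2 * k) = a + 3 * k by omega] at s4
    constructor <;> omega

theorem stayCount_bounds {k : ℕ} (hk : 1 ≤ k) (N : ℕ) :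
    ∀ a : ℤ, |2 * a - N| ≤ k →
      imagesThree k N a ≤ stayCount k N a ∧ stayCount k N a ≤ imagesTwo k N a := by
  induction N with
  | zero =>
    intro a ha
    have ha' := abs_le.1 ha
    have e : imagesTwo k 0 a = zchoose 0 a := by
      unfold imagesTwo
      rw [zchoose_zero_of_ne (x := a + k) (by omega), zchoose_zero_of_ne (x := a - k) (by omega),
        zchoose_zero_of_ne (x := a + 2 * k) (by omega),
        zchoose_zero_of_ne (x := a - 2 * k) (by omega)]
      ring
    have e' : imagesThree k 0 a = zchoose 0 a := by
      unfold imagesThree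
      rw [e, zchoose_zero_of_ne (x := a + 3 * k) (by omega),
        zchoose_zero_of_ne (x := a - 3 * k) (by omega)]
      ring
    have hs : stayCount k 0 a = zchoose 0 a := by
      unfold stayCount
      rcases eq_or_ne a 0 with rfl | h
      · rw [range_zero, powerset_empty, sum_singleton, if_pos]
        · rfl
        · exact ⟨rfl, fun i hi => by obtain rfl : i = 0 := by omega
                                     simpa using Nat.pos_of_ne_zero (by omega : k ≠ 0)⟩
      · rw [zchoose_zero_of_ne h, range_zero, powerset_empty, sum_singleton, if_neg]
        exact fun hin => h hin.1.symm
    rw [e, e', hs]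
    exact ⟨le_rfl, le_rfl⟩
  | succ N ih =>
    intro a ha
    rcases ha.lt_or_eq with hlt | heq
    · have h' := abs_lt.1 hlt
      push_cast at h'
      have h1 := ih a (abs_le.2 ⟨by omega, by omega⟩)
      have h2 := ih (a - 1) (abs_le.2 ⟨by omega, by omega⟩)
      rw [stayCount_succ hlt, imagesTwo_succ, imagesThree_succ]
      omega
    · rw [stayCount_eq_zero heq.ge]
      exact (images_boundary heq).symm

open Classical in
/-- The number of walks with `n` up-steps and `n` down-steps that reach `k` or `-k`. -/
noncomputable def crossCount (n k : ℕ) : ℕ :=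
  #{S ∈ powersetCard n (range (2 * n)) |
    ∃ i ≤ 2 * n, (k : ℤ) ≤ |2 * (#{x ∈ S | x < i} : ℤ) - i|}

theorem crossCount_add_stayCount (n k : ℕ) :
    (crossCount n k : ℤ) + stayCount k (2 * n) n = (2 * n).choose n := by
  classical
  have h := card_filter_add_card_filter_not (s := powersetCard n (range (2 * n)))
    (fun S => ∃ i ≤ 2 * n, (k : ℤ) ≤ |2 * (#{x ∈ S | x < i} : ℤ) - i|)
  rw [card_powersetCard, card_range] at h
  have h2 : stayCount k (2 * n) n = #{S ∈ powersetCard n (range (2 * n)) |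
    ¬ ∃ i ≤ 2 * n, (k : ℤ) ≤ |2 * (#{x ∈ S | x < i} : ℤ) - i|} := by
    unfold stayCount
    rw [sum_boole]
    congr 2
    ext S
    simp only [mem_filter, mem_powerset, mem_powersetCard, StaysInside, not_exists, not_and, not_le,
      Nat.cast_inj, and_assoc]
  rw [h2, ← h]
  push_cast
  rw [crossCount]

theorem crossCount_bounds {n k : ℕ} (hk : 1 ≤ k) :
    2 * ((2 * n).choose (n + k) : ℤ) - 2 * (2 * n).choose (n + 2 * k) ≤ crossCount n k ∧
    (crossCount n k : ℤ) ≤ 2 * (2 * n).choose (n + k) - 2 * (2 * n).choose (n + 2 * k)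
      + 2 * (2 * n).choose (n + 3 * k) := by
  have h1 := stayCount_bounds hk (2 * n) n (by push_cast; simp)
  have h2 := crossCount_add_stayCount n k
  have hp : ∀ j : ℕ, zchoose (2 * n) ((n : ℤ) + j) = (2 * n).choose (n + j) := fun j => by
    rw [← Nat.cast_add, zchoose_natCast]
  have hm : ∀ j : ℕ, zchoose (2 * n) ((n : ℤ) - j) = (2 * n).choose (n + j) := fun j => by
    rw [← zchoose_symm, ← hp]; congr 1; push_cast; ring
  have h0 := hp 0
  have a1 := hp k
  have a2 := hp (2 * k)
  have a3 := hp (3 * k)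
  have b1 := hm k
  have b2 := hm (2 * k)
  have b3 := hm (3 * k)
  push_cast at h0 a1 a2 a3 b1 b2 b3
  simp only [add_zero] at h0
  unfold imagesThree imagesTwo at h1
  rw [h0, a1, a2, a3, b1, b2, b3] at h1
  constructor <;> omega

/-- The proportion of balanced walks reaching `k` or `-k`. -/
noncomputable def crossProb (n k : ℕ) : ℝ := (crossCount n k : ℝ) / (2 * n).choose n

theorem crossProb_bounds {n k : ℕ} (hk : 1 ≤ k) :
    2 * (centralRatio n k - centralRatio n (2 * k)) ≤ crossProb n k ∧
    crossProb n k ≤ 2 * (centralRatio n k - centralRatio n (2 * k) + centralRatio n (3 * k)) := by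
  obtain ⟨h1, h2⟩ := crossCount_bounds (n := n) hk
  have hpos : (0 : ℝ) < (2 * n).choose n := by exact_mod_cast Nat.choose_pos (by omega)
  have h1' := (Int.cast_le (R := ℝ)).2 h1
  have h2' := (Int.cast_le (R := ℝ)).2 h2
  push_cast at h1' h2'
  simp only [centralRatio_eq, crossProb]
  rw [← sub_div, ← add_div, ← mul_div_assoc, ← mul_div_assoc]
  constructor
  · gcongr; linarith
  · gcongr; linarith

section Exchangeable

variable {ι : Type} [Fintype ι]

/-- At some level `t`, the number of `i ∈ S` with `z i ≤ t` differs by at least `k` from the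
number of `i ∉ S` with `z i ≤ t`. -/
def Reaches (z : ι → ℝ) (S : Finset ι) (k : ℕ) : Prop :=
  ∃ t : ℝ, (k : ℤ) ≤ |2 * (#{i ∈ S | z i ≤ t} : ℤ) - #{i | z i ≤ t}|

theorem reaches_iff_exists_index {z : ι → ℝ} {S : Finset ι} {k : ℕ} (hk : 1 ≤ k) :
    Reaches z S k ↔ ∃ j, (k : ℤ) ≤ |2 * (#{i ∈ S | z i ≤ z j} : ℤ) - #{i | z i ≤ z j}| := by
  constructor
  · rintro ⟨t, ht⟩
    rcases ({i | z i ≤ t} : Finset ι).eq_empty_or_nonempty with h0 | h0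
    · have h1 : ({i ∈ S | z i ≤ t} : Finset ι) = ∅ := by
        rw [← subset_empty, ← h0]
        exact filter_subset_filter _ (subset_univ S)
      rw [h0, h1] at ht
      simp at ht
      omega
    · obtain ⟨j, hj, hmax⟩ := exists_max_image _ z h0
      have hj' : z j ≤ t := by simpa using hj
      refine ⟨j, ?_⟩
      have key : ∀ i, z i ≤ z j ↔ z i ≤ t := fun i =>
        ⟨fun h => h.trans hj', fun h => hmax i (by simpa using h)⟩
      simpa only [key] using ht
  · rintro ⟨j, hj⟩
    exact ⟨z j, hj⟩

theorem measurableSet_reaches (S : Finset ι) {k : ℕ} (hk : 1 ≤ k) :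
    MeasurableSet {z : ι → ℝ | Reaches z S k} := by
  classical
  simp_rw [reaches_iff_exists_index hk]
  rw [Set.ofPred_exists]
  refine MeasurableSet.iUnion fun j => ?_
  have hcount : ∀ T : Finset ι, Measurable fun z : ι → ℝ => (#{i ∈ T | z i ≤ z j} : ℤ) := by
    intro T
    have e : (fun z : ι → ℝ => (#{i ∈ T | z i ≤ z j} : ℤ))
        = fun z => ∑ i ∈ T, if z i ≤ z j then (1 : ℤ) else 0 := by
      funext z; rw [sum_boole]
    rw [e]
    refine Finset.measurable_sum _ fun i _ => Measurable.ite ?_ measurable_const measurable_const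
    exact measurableSet_le (measurable_pi_apply i) (measurable_pi_apply j)
  have hf : Measurable fun z : ι → ℝ =>
      2 * (#{i ∈ S | z i ≤ z j} : ℤ) - (#{i | z i ≤ z j} : ℤ) :=
    ((hcount S).const_mul 2).sub (hcount univ)
  exact hf (MeasurableSet.of_discrete (s := {m : ℤ | (k : ℤ) ≤ |m|}))

theorem reaches_comp_perm (z : ι → ℝ) (σ : Equiv.Perm ι) (S : Finset ι) (k : ℕ) :
    Reaches (z ∘ σ) S k ↔ Reaches z (S.map σ.toEmbedding) k := by
  unfold Reaches
  refine exists_congr fun t => ?_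
  have h1 : ∀ T : Finset ι, #{i ∈ T.map σ.toEmbedding | z i ≤ t} = #{i ∈ T | (z ∘ σ) i ≤ t} := by
    intro T
    rw [filter_map, card_map]
    rfl
  have h2 := h1 univ
  rw [map_univ_equiv] at h2
  rw [h1, h2]

/-- The number of coordinates below the `i`th one. -/
noncomputable def rank (z : ι → ℝ) (i : ι) : ℕ := #{j | z j < z i}

theorem rank_lt_iff (z : ι → ℝ) (t : ℝ) (i : ι) : rank z i < #{j | z j ≤ t} ↔ z i ≤ t := by
  constructor
  · intro h
    by_contra hlt
    refine absurd h (not_lt.2 (card_le_card fun j hj => ?_))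
    simp only [mem_filter, mem_univ, true_and] at hj ⊢
    exact hj.trans_lt (not_le.1 hlt)
  · intro h
    refine card_lt_card ⟨fun j hj => ?_, fun hsub => ?_⟩
    · simp only [mem_filter, mem_univ, true_and] at hj ⊢
      exact hj.le.trans h
    · have := hsub (show i ∈ _ by simpa using h)
      simp at this

theorem rank_injective {z : ι → ℝ} (hz : Function.Injective z) : Function.Injective (rank z) := by
  intro i j hij
  apply hz
  have key : ∀ a b, rank z a = rank z b → z a ≤ z b := fun a b h => by
    rw [← rank_lt_iff, h, rank_lt_iff]
  exact le_antisymm (key i j hij) (key j i hij.symm)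

theorem map_rank_univ {z : ι → ℝ} (hz : Function.Injective z) :
    (univ : Finset ι).map ⟨rank z, rank_injective hz⟩ = range (Fintype.card ι) := by
  refine eq_of_subset_of_card_le (fun m hm => ?_) (by simp)
  obtain ⟨i, -, rfl⟩ := mem_map.1 hm
  refine mem_range.2 (card_lt_card ⟨subset_univ _, fun hsub => ?_⟩)
  have := hsub (mem_univ i)
  simp at this

theorem reaches_iff_walk {z : ι → ℝ} (hz : Function.Injective z) (S : Finset ι) {k : ℕ}
    (hk : 1 ≤ k) :
    Reaches z S k ↔ ∃ m ≤ Fintype.card ι, (k : ℤ) ≤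
      |2 * (#{x ∈ S.map ⟨rank z, rank_injective hz⟩ | x < m} : ℤ) - m| := by
  have hcard : ∀ m, #{x ∈ S.map ⟨rank z, rank_injective hz⟩ | x < m} = #{i ∈ S | rank z i < m} :=
    fun m => by rw [filter_map, card_map]; rfl
  simp only [hcard]
  constructor
  · rintro ⟨t, ht⟩
    refine ⟨#{j | z j ≤ t}, card_le_univ _, ?_⟩
    simpa only [rank_lt_iff] using ht
  · rintro ⟨m, hm, h⟩
    rcases Nat.eq_zero_or_pos m with rfl | hpos
    · simp at h
      omega
    · have hmem : m - 1 ∈ (univ : Finset ι).map ⟨rank z, rank_injective hz⟩ := by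
        rw [map_rank_univ hz, mem_range]; omega
      obtain ⟨i, -, hi⟩ := mem_map.1 hmem
      change rank z i = m - 1 at hi
      refine ⟨z i, ?_⟩
      have hle : ∀ j, rank z j < m ↔ z j ≤ z i := by
        intro j
        constructor
        · intro hj
          have : rank z j ≤ rank z i := by omega
          by_contra hlt
          have h1 : rank z i < #{l | z l ≤ z i} := (rank_lt_iff z (z i) i).2 le_rfl
          have h2 : #{l | z l ≤ z i} ≤ rank z j := by
            by_contra hcon
            exact hlt ((rank_lt_iff z (z i) j).1 (not_le.1 hcon))
          omega
        · intro hj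
          have : rank z j ≤ rank z i := card_le_card fun l hl => by
            simp only [mem_filter, mem_univ, true_and] at hl ⊢
            exact hl.trans_le hj
          omega
      have hcount : #{j | z j ≤ z i} = m := by
        have e : #{x ∈ (univ : Finset ι).map ⟨rank z, rank_injective hz⟩ | x < m}
            = #{j | rank z j < m} := by
          rw [filter_map, card_map]; rfl
        simp only [hle] at e
        rw [← e, map_rank_univ hz]
        have : ({x ∈ range (Fintype.card ι) | x < m} : Finset ℕ) = range m := by
          ext x; simp; omega
        rw [this, card_range]
      rw [hcount]
      simpa only [hle] using h

open Classical in
theorem card_reaches {n : ℕ} (hι : Fintype.card ι = 2 * n) {z : ι → ℝ}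
    (hz : Function.Injective z) {k : ℕ} (hk : 1 ≤ k) :
    #{S ∈ powersetCard n (univ : Finset ι) | Reaches z S k} = crossCount n k := by
  rw [crossCount, ← hι, ← map_rank_univ hz, powersetCard_map, filter_map, card_map]
  congr 1
  refine filter_congr fun S _ => ?_
  exact reaches_iff_walk hz S hk

variable (μ : Measure ℝ) [IsProbabilityMeasure μ]

theorem map_comp_perm_pi (σ : Equiv.Perm ι) :
    (Measure.pi fun _ : ι => μ).map (fun z => z ∘ σ) = Measure.pi fun _ : ι => μ := by
  refine (Measure.pi_eq fun s hs => ?_).symm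
  have hmeas : Measurable fun z : ι → ℝ => z ∘ σ :=
    measurable_pi_lambda _ fun i => measurable_pi_apply (σ i)
  rw [Measure.map_apply hmeas (MeasurableSet.univ_pi hs)]
  have e : (fun z : ι → ℝ => z ∘ σ) ⁻¹' Set.univ.pi s = Set.univ.pi fun i => s (σ.symm i) := by
    ext z
    simp only [Set.mem_preimage, Set.mem_univ_pi, Function.comp_apply]
    exact ⟨fun h i => by simpa using h (σ.symm i), fun h i => by simpa using h (σ i)⟩
  rw [e, Measure.pi_pi]
  exact Equiv.prod_comp σ.symm fun i => μ (s i)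

theorem pi_reaches_eq {S T : Finset ι} (h : #S = #T) {k : ℕ} (hk : 1 ≤ k) :
    (Measure.pi fun _ : ι => μ).real {z | Reaches z S k}
      = (Measure.pi fun _ : ι => μ).real {z | Reaches z T k} := by
  obtain ⟨σ, hσ⟩ := Equiv.Perm.exists_map_finset_eq S T h
  have hmeas : Measurable fun z : ι → ℝ => z ∘ σ :=
    measurable_pi_lambda _ fun i => measurable_pi_apply (σ i)
  rw [measureReal_def, measureReal_def, ← map_comp_perm_pi μ σ,
    Measure.map_apply hmeas (measurableSet_reaches S hk), map_comp_perm_pi μ σ]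
  congr 2
  ext z
  simp only [Set.mem_preimage, Set.mem_ofPred_eq, reaches_comp_perm, hσ]

theorem ae_injective_pi [NullSingletonClass μ] :
    ∀ᵐ z ∂(Measure.pi fun _ : ι => μ), Function.Injective z := by
  have hpair : ∀ i j : ι, i ≠ j → ∀ᵐ z ∂(Measure.pi fun _ : ι => μ), z i ≠ z j := by
    intro i j hij
    have hind : iIndepFun (fun (i : ι) (z : ι → ℝ) => z i) (Measure.pi fun _ : ι => μ) :=
      iIndepFun_pi (X := fun _ => id) fun _ => aemeasurable_id
    have hprod := (indepFun_iff_map_prod_eq_prod_map_map (measurable_pi_apply i).aemeasurable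
      (measurable_pi_apply j).aemeasurable).1 (hind.indepFun hij)
    have hi : (Measure.pi fun _ : ι => μ).map (fun z => z i) = μ :=
      (measurePreserving_eval (fun _ : ι => μ) i).map_eq
    have hj : (Measure.pi fun _ : ι => μ).map (fun z => z j) = μ :=
      (measurePreserving_eval (fun _ : ι => μ) j).map_eq
    rw [hi, hj] at hprod
    have hdiag : (μ.prod μ) (Set.diagonal ℝ) = 0 := by
      rw [Measure.measure_prod_null measurableSet_diagonal]
      refine Filter.Eventually.of_forall fun x => ?_
      have : Prod.mk x ⁻¹' Set.diagonal ℝ = {x} := by ext y; simp [eq_comm]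
      simp [this]
    rw [← hprod, Measure.map_apply (by fun_prop) measurableSet_diagonal] at hdiag
    exact measure_eq_zero_iff_ae_notMem.1 hdiag
  have : ∀ᵐ z ∂(Measure.pi fun _ : ι => μ), ∀ i j : ι, i ≠ j → z i ≠ z j := by
    simp only [ae_all_iff]
    exact fun i j hij => hpair i j hij
  filter_upwards [this] with z hz i j hij
  by_contra hne
  exact hz i j hne hij

/-- The distribution-free value of the tail probability. -/
theorem pi_reaches [NullSingletonClass μ] {n : ℕ} (hι : Fintype.card ι = 2 * n)
    {S : Finset ι} (hS : #S = n) {k : ℕ} (hk : 1 ≤ k) :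
    (Measure.pi fun _ : ι => μ).real {z | Reaches z S k} = crossProb n k := by
  classical
  have hpos : (0 : ℝ) < (2 * n).choose n := by exact_mod_cast Nat.choose_pos (by omega)
  set ν := Measure.pi fun _ : ι => μ with hν
  have hsum : ∑ T ∈ powersetCard n (univ : Finset ι), ν.real {z | Reaches z T k}
      = (2 * n).choose n * ν.real {z | Reaches z S k} := by
    rw [sum_congr rfl fun T hT =>
      pi_reaches_eq μ (((mem_powersetCard.1 hT).2).trans hS.symm) hk, sum_const,
      card_powersetCard, card_univ, hι, nsmul_eq_mul]
  have hint : ∑ T ∈ powersetCard n (univ : Finset ι), ν.real {z | Reaches z T k}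
      = crossCount n k := by
    calc _ = ∑ T ∈ powersetCard n (univ : Finset ι),
          ∫ z, {z | Reaches z T k}.indicator (fun _ => (1 : ℝ)) z ∂ν := by
          refine sum_congr rfl fun T _ => ?_
          rw [integral_indicator (measurableSet_reaches T hk)]
          simp [measureReal_def]
      _ = ∫ z, ∑ T ∈ powersetCard n (univ : Finset ι),
          {z | Reaches z T k}.indicator (fun _ => (1 : ℝ)) z ∂ν :=
          (integral_finsetSum _ fun T _ =>
            (integrable_const (1 : ℝ)).indicator (measurableSet_reaches T hk)).symm
      _ = ∫ _, (crossCount n k : ℝ) ∂ν := by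
          refine integral_congr_ae ?_
          filter_upwards [ae_injective_pi μ] with z hz
          rw [← card_reaches hι hz hk, ← sum_boole]
          exact sum_congr rfl fun T _ => by simp [Set.indicator_apply]
      _ = crossCount n k := by simp
  rw [crossProb, eq_div_iff hpos.ne', mul_comm, ← hsum, hint]

end Exchangeable

theorem nullSingletonClass_of_continuous {μ : Measure ℝ} [IsProbabilityMeasure μ] {F : ℝ → ℝ}
    (hF : Continuous F) (h : ∀ t, μ.real (Set.Iic t) = F t) : NullSingletonClass μ := by
  refine ⟨fun x => ?_⟩
  have hle : ∀ s < x, μ.real {x} ≤ F x - F s := by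
    intro s hs
    rw [← h x, ← h s, ← measureReal_sdiff (Set.Iic_subset_Iic.2 hs.le) measurableSet_Iic]
    exact measureReal_mono fun y hy => by
      rw [Set.mem_singleton_iff.1 hy]
      exact ⟨Set.mem_Iic.2 le_rfl, fun h' => absurd (Set.mem_Iic.1 h') (not_le.2 hs)⟩
  have hlim : Filter.Tendsto (fun s => F x - F s) (nhdsWithin x (Set.Iio x)) (nhds 0) := by
    have : Filter.Tendsto (fun s => F x - F s) (nhds x) (nhds (F x - F x)) :=
      (continuous_const.sub hF).tendsto x
    rw [sub_self] at this
    exact this.mono_left nhdsWithin_le_nhds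
  have h0 : μ.real {x} ≤ 0 :=
    ge_of_tendsto hlim (by filter_upwards [self_mem_nhdsWithin] with s hs using hle s hs)
  exact (measureReal_eq_zero_iff).1 (le_antisymm h0 measureReal_nonneg)

theorem card_inl (n m : ℕ) :
    #((univ : Finset (Fin n)).map (Function.Embedding.inl : Fin n ↪ Fin n ⊕ Fin m)) = n := by simp

theorem natCast_sqrt_div {n : ℕ} (hn : 1 ≤ n) :
    Real.sqrt ((n : ℝ) * n / ((n : ℝ) + n)) = n / Real.sqrt (2 * n) := by
  have hn' : (0 : ℝ) < n := by exact_mod_cast hn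
  rw [← two_mul, Real.sqrt_div (by positivity), Real.sqrt_mul_self hn'.le]

theorem empiricalDF_sub {n : ℕ} (x y : Fin n → ℝ) (t : ℝ) :
    empiricalDF x t - empiricalDF y t =
      ((2 * (#{i ∈ (univ : Finset (Fin n)).map (Function.Embedding.inl : Fin n ↪ Fin n ⊕ Fin n) |
        Sum.elim x y i ≤ t} : ℤ) - #{i | Sum.elim x y i ≤ t} : ℤ) : ℝ) / n := by
  have h1 : #{i ∈ (univ : Finset (Fin n)).map (Function.Embedding.inl : Fin n ↪ Fin n ⊕ Fin n) |
      Sum.elim x y i ≤ t} = #{i | x i ≤ t} := by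
    rw [filter_map, card_map]; rfl
  have h2 : #{i | Sum.elim x y i ≤ t} = #{i | x i ≤ t} + #{i | y i ≤ t} := by
    simp only [card_filter, Fintype.sum_sum_type, Sum.elim_inl, Sum.elim_inr]
    rfl
  rw [h1, h2, empiricalDF, empiricalDF, Nat.card_eq_fintype_card, Nat.card_eq_fintype_card,
    Fintype.card_subtype, Fintype.card_subtype, ← sub_div]
  push_cast
  congr 1
  ring

theorem le_statD_iff {n : ℕ} (x y : Fin n → ℝ) (c : ℝ) :
    c ≤ statD x y ↔ ∃ t, c ≤ |empiricalDF x t - empiricalDF y t| := by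
  have hfin : (Set.range fun t => |empiricalDF x t - empiricalDF y t|).Finite := by
    have hE : ∀ z : Fin n → ℝ, (Set.range (empiricalDF z)).Finite := by
      intro z
      refine ((Set.finite_Iic n).image fun a : ℕ => (a : ℝ) / n).subset ?_
      rintro _ ⟨t, rfl⟩
      refine ⟨Nat.card {i : Fin n // z i ≤ t}, ?_, rfl⟩
      simpa using Nat.card_le_card_of_injective
        (Subtype.val : {i : Fin n // z i ≤ t} → Fin n) Subtype.val_injective
    refine (((hE x).prod (hE y)).image fun p : ℝ × ℝ => |p.1 - p.2|).subset ?_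
    rintro _ ⟨t, rfl⟩
    exact ⟨(empiricalDF x t, empiricalDF y t), ⟨⟨t, rfl⟩, ⟨t, rfl⟩⟩, rfl⟩
  constructor
  · intro h
    obtain ⟨t, ht⟩ := (Set.range_nonempty _).csSup_mem hfin
    exact ⟨t, h.trans_eq ht.symm⟩
  · rintro ⟨t, ht⟩
    exact ht.trans (le_ciSup hfin.bddAbove t)

theorem le_statKS_iff {n : ℕ} (hn : 1 ≤ n) (x y : Fin n → ℝ) (M : ℝ) :
    M ≤ statKS x y ↔ Reaches (Sum.elim x y)
      ((univ : Finset (Fin n)).map (Function.Embedding.inl : Fin n ↪ Fin n ⊕ Fin n))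
      ⌈M * Real.sqrt (2 * n)⌉₊ := by
  have hn' : (0 : ℝ) < n := by exact_mod_cast hn
  have hs : 0 < Real.sqrt (2 * n) := Real.sqrt_pos.2 (by positivity)
  rw [statKS, natCast_sqrt_div hn, ← div_le_iff₀' (by positivity), le_statD_iff]
  refine exists_congr fun t => ?_
  rw [empiricalDF_sub, abs_div, abs_of_pos hn', div_le_div_iff₀ (by positivity) hn',
    ← Int.cast_abs]
  set q : ℤ := |2 * (#{i ∈ (univ : Finset (Fin n)).map
      (Function.Embedding.inl : Fin n ↪ Fin n ⊕ Fin n) | Sum.elim x y i ≤ t} : ℤ)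
      - #{i | Sum.elim x y i ≤ t}| with hq
  obtain ⟨a, ha⟩ : ∃ a : ℕ, q = a := ⟨q.toNat, (Int.toNat_of_nonneg (abs_nonneg _)).symm⟩
  rw [ha, Nat.cast_le, Nat.ceil_le, Int.cast_natCast]
  have e : (a : ℝ) * (n / Real.sqrt (2 * n)) = (a : ℝ) * n / Real.sqrt (2 * n) := by ring
  rw [e, le_div_iff₀ hs]
  constructor
  · intro h
    have : n * (M * Real.sqrt (2 * n)) ≤ n * (a : ℝ) := by linarith
    exact le_of_mul_le_mul_left this hn'
  · intro h
    nlinarith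

theorem tailProb_eq {n : ℕ} (hn : 1 ≤ n) {Ω : Type u} [MeasurableSpace Ω] {P : Measure Ω}
    [IsProbabilityMeasure P] {F : ℝ → ℝ} {X Y : Fin n → Ω → ℝ} (h : NullHypothesis P F X Y)
    {M : ℝ} (hM : 0 < M) :
    tailProb P X Y M = crossProb n ⌈M * Real.sqrt (2 * n)⌉₊ := by
  have hn' : (0 : ℝ) < n := by exact_mod_cast hn
  have hk : 1 ≤ ⌈M * Real.sqrt (2 * n)⌉₊ := Nat.ceil_pos.2 (by positivity)
  have hmeas : ∀ i, Measurable (Sum.elim X Y i) := by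
    rintro (i | i)
    · exact h.measurable_X i
    · exact h.measurable_Y i
  have hdf : ∀ i t, (P.map (Sum.elim X Y i)).real (Set.Iic t) = F t := by
    intro i t
    rw [map_measureReal_apply (hmeas i) measurableSet_Iic]
    rcases i with i | i
    · exact h.df_X i t
    · exact h.df_Y i t
  have hprob : ∀ i, IsProbabilityMeasure (P.map (Sum.elim X Y i)) := fun i =>
    Measure.isProbabilityMeasure_map (hmeas i).aemeasurable
  set μ := P.map (Sum.elim X Y (Sum.inl ⟨0, hn⟩)) with hμ
  have hlaw : ∀ i, P.map (Sum.elim X Y i) = μ := fun i => by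
    refine Measure.ext_of_Iic _ _ fun t => ?_
    rw [← ENNReal.toReal_eq_toReal_iff' (measure_ne_top _ _) (measure_ne_top _ _)]
    exact (hdf i t).trans (hdf _ t).symm
  have : NullSingletonClass μ := nullSingletonClass_of_continuous h.continuous_F (hdf _)
  have hjoint := (iIndepFun_iff_map_fun_eq_pi_map fun i => (hmeas i).aemeasurable).1 h.indep
  simp only [hlaw] at hjoint
  rw [← pi_reaches μ (ι := Fin n ⊕ Fin n) (by simp; ring) (card_inl n n) hk, ← hjoint,
    map_measureReal_apply (measurable_pi_lambda _ hmeas) (measurableSet_reaches _ hk), tailProb]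
  congr 1
  ext ω
  rw [Set.mem_ofPred_eq, le_statKS_iff hn]
  have e : Sum.elim (fun i => X i ω) (fun j => Y j ω) = fun i => Sum.elim X Y i ω := by
    funext i; rcases i with i | i <;> rfl
  rw [e]
  rfl

theorem possibleM_self {n : ℕ} (hn : 1 ≤ n) (k : ℕ) :
    possibleM n n k = k / Real.sqrt (2 * n) := by
  have hn' : (0 : ℝ) < n := by exact_mod_cast hn
  have hs : 0 < Real.sqrt (2 * n) := Real.sqrt_pos.2 (by positivity)
  rw [possibleM, natCast_sqrt_div hn, Nat.lcm_self]
  field_simp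

theorem tailProb_possibleM {n k : ℕ} (hn : 1 ≤ n) (hk : 1 ≤ k) {Ω : Type u} [MeasurableSpace Ω]
    {P : Measure Ω} [IsProbabilityMeasure P] {F : ℝ → ℝ} {X Y : Fin n → Ω → ℝ}
    (h : NullHypothesis P F X Y) : tailProb P X Y (possibleM n n k) = crossProb n k := by
  have hn' : (0 : ℝ) < n := by exact_mod_cast hn
  have hk' : (0 : ℝ) < k := by exact_mod_cast hk
  have hs : 0 < Real.sqrt (2 * n) := Real.sqrt_pos.2 (by positivity)
  rw [tailProb_eq hn h (by rw [possibleM_self hn]; positivity), possibleM_self hn,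
    div_mul_cancel₀ _ hs.ne', Nat.ceil_natCast]

theorem exp_possibleM {n : ℕ} (hn : 1 ≤ n) (k : ℕ) :
    -2 * possibleM n n k ^ 2 = -((k : ℝ) ^ 2 / n) := by
  have hn' : (0 : ℝ) < n := by exact_mod_cast hn
  rw [possibleM_self hn, div_pow, Real.sq_sqrt (by positivity)]
  field_simp

theorem dkwHolds_of_threeTermLe {n : ℕ} (hn : 1 ≤ n) {c : ℝ} (hc : 0 ≤ c)
    (h : ThreeTermLe n c) : DKWHolds.{u} n n (2 * c) := by
  intro Ω _ P _ F X Y hnull M hM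
  have hn' : (0 : ℝ) < n := by exact_mod_cast hn
  have hs : 0 < Real.sqrt (2 * n) := Real.sqrt_pos.2 (by positivity)
  have hk : 1 ≤ ⌈M * Real.sqrt (2 * n)⌉₊ := Nat.ceil_pos.2 (by positivity)
  rw [tailProb_eq hn hnull hM]
  set k := ⌈M * Real.sqrt (2 * n)⌉₊
  have hMk : M * Real.sqrt (2 * n) ≤ k := Nat.le_ceil _
  have hsq : 2 * M ^ 2 ≤ (k : ℝ) ^ 2 / n := by
    rw [le_div_iff₀ hn']
    have := pow_le_pow_left₀ (by positivity) hMk 2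
    rw [mul_pow, Real.sq_sqrt (by positivity)] at this
    linarith
  calc crossProb n k
      ≤ 2 * (centralRatio n k - centralRatio n (2 * k) + centralRatio n (3 * k)) :=
        (crossProb_bounds hk).2
    _ ≤ 2 * (c * Real.exp (-((k : ℝ) ^ 2 / n))) := by
        have := h k hk; linarith
    _ ≤ 2 * (c * Real.exp (-2 * M ^ 2)) := by
        gcongr; linarith
    _ = _ := by ring

theorem dkwFailsAt_of_lt {n k : ℕ} (hn : 1 ≤ n) (hk : 1 ≤ k)
    (h : Real.exp (-((k : ℝ) ^ 2 / n)) < centralRatio n k - centralRatio n (2 * k)) :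
    DKWFailsAt.{u} n n 2 (possibleM n n k) := by
  intro Ω _ P _ F X Y hnull
  rw [tailProb_possibleM hn hk hnull, exp_possibleM hn]
  linarith [(crossProb_bounds (n := n) hk).1]

/-- The null hypothesis holds for the coordinates of independent uniform variables. -/
theorem exists_nullHypothesis (m n : ℕ) :
    ∃ (Ω : Type u) (_ : MeasurableSpace Ω) (P : Measure Ω) (_ : IsProbabilityMeasure P)
      (F : ℝ → ℝ) (X : Fin m → Ω → ℝ) (Y : Fin n → Ω → ℝ), NullHypothesis P F X Y := by
  set μ : Measure ℝ := volume.restrict (Set.Icc 0 1) with hμ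
  have hμp : IsProbabilityMeasure μ := ⟨by simp [hμ]⟩
  set ν : Measure (Fin m ⊕ Fin n → ℝ) := Measure.pi fun _ => μ with hν
  set P : Measure (ULift.{u} (Fin m ⊕ Fin n → ℝ)) := ν.map ULift.up with hP
  have hPp : IsProbabilityMeasure P := Measure.isProbabilityMeasure_map measurable_up.aemeasurable
  let Z : Fin m ⊕ Fin n → ULift.{u} (Fin m ⊕ Fin n → ℝ) → ℝ := fun i ω => ω.down i
  have hZ : ∀ i, Measurable (Z i) := fun i => (measurable_pi_apply i).comp measurable_down
  have hlaw : ∀ i, P.map (Z i) = μ := fun i => by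
    rw [hP, Measure.map_map (hZ i) measurable_up]
    exact (measurePreserving_eval (fun _ : Fin m ⊕ Fin n => μ) i).map_eq
  have hdf : ∀ i t, P.real {ω | Z i ω ≤ t} = max (min t 1) 0 := by
    intro i t
    have : P.real (Z i ⁻¹' Set.Iic t) = μ.real (Set.Iic t) := by
      rw [← map_measureReal_apply (hZ i) measurableSet_Iic, hlaw]
    refine this.trans ?_
    have e : Set.Iic t ∩ Set.Icc (0 : ℝ) 1 = Set.Icc 0 (min t 1) := by
      ext x
      simp only [Set.mem_inter_iff, Set.mem_Iic, Set.mem_Icc, le_min_iff]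
      tauto
    rw [measureReal_def, hμ, Measure.restrict_apply measurableSet_Iic, e, Real.volume_Icc,
      sub_zero, ENNReal.toReal_ofReal']
  refine ⟨_, inferInstance, P, hPp, fun t => max (min t 1) 0, fun i => Z (Sum.inl i),
    fun j => Z (Sum.inr j), ?_⟩
  refine ⟨by fun_prop, fun i => hZ _, fun j => hZ _, fun i t => hdf _ t, fun j t => hdf _ t, ?_⟩
  have e : Sum.elim (fun i => Z (Sum.inl i)) (fun j => Z (Sum.inr j)) = Z := by
    funext i; rcases i with i | i <;> rfl
  rw [e, iIndepFun_iff_map_fun_eq_pi_map fun i => (hZ i).aemeasurable]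
  simp only [hlaw]
  rw [hP, Measure.map_map (measurable_pi_lambda _ hZ) measurable_up]
  exact Measure.map_id

theorem canReject_four : CanReject.{u} 4 4 0.05 := by
  refine ⟨4, by norm_num, by norm_num, fun Ω _ P _ F X Y h => ?_⟩
  rw [tailProb_possibleM (by norm_num) (by norm_num) h]
  refine (crossProb_bounds (by norm_num)).2.trans ?_
  have := three_term_le_first 4 4
  have e : centralRatio 4 4 = 1 / 70 := by norm_num [centralRatio, prod_range_succ]
  rw [e] at this
  norm_num at this ⊢
  linarith

theorem not_canReject {n : ℕ} (hn : 1 ≤ n) (hn3 : n < 4) : ¬ CanReject.{u} n n 0.05 := by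
  rintro ⟨k, hk1, hkn, h⟩
  rw [Nat.lcm_self] at hkn
  obtain ⟨Ω, _, P, _, F, X, Y, hnull⟩ := exists_nullHypothesis.{u} n n
  have h1 := h Ω P F X Y hnull
  rw [tailProb_possibleM hn hk1 hnull] at h1
  have h2 := (crossProb_bounds (n := n) hk1).1
  have h3 : (0.05 : ℝ) < 2 * (centralRatio n k - centralRatio n (2 * k)) := by
    interval_cases n <;> interval_cases k <;> norm_num [centralRatio, prod_range_succ]
  linarith

end TwoSample

theorem theorem1 :
    -- (a)
    (∀ n : ℕ, 1 ≤ n → TwoSample.DKWHolds.{u} n n (Real.exp 1)) ∧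
    -- (b)
    ((∀ n : ℕ, 4 ≤ n → TwoSample.DKWHolds.{u} n n 2.16863) ∧
      IsLeast {n : ℕ | 1 ≤ n ∧ TwoSample.CanReject.{u} n n 0.05} 4) ∧
    -- (c)
    (∀ n : ℕ, 458 ≤ n → TwoSample.DKWHolds.{u} n n 2) ∧
    -- (d)
    (∀ n : ℕ, 1 ≤ n → n < 458 →
      ∃ k : ℕ, 1 ≤ k ∧ k ≤ Nat.lcm n n ∧
        TwoSample.DKWFailsAt.{u} n n 2 (TwoSample.possibleM n n k)) ∧
    -- (e)
    (∃ δ : ℕ → ℝ, ∀ n : ℕ, 1 ≤ n → n < 458 →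
      0 < δ n ∧ TwoSample.DKWHolds.{u} n n (2 * (1 + δ n)) ∧
        (12 ≤ n → δ n < -(0.07 / (n : ℝ)) + 40 / (n : ℝ) ^ 2 - 400 / (n : ℝ) ^ 3)) := by
  have ha : ∀ n : ℕ, 1 ≤ n → TwoSample.DKWHolds.{u} n n (Real.exp 1) := fun n hn => by
    have := TwoSample.dkwHolds_of_threeTermLe.{u} hn (by positivity)
      (TwoSample.threeTermLe_exp_one hn)
    rwa [mul_div_cancel₀ _ two_ne_zero] at this
  refine ⟨ha, ⟨fun n hn => ?_, ⟨by norm_num, TwoSample.canReject_four⟩, fun n hn => ?_⟩,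
    fun n hn => ?_, fun n h1 h2 => ?_,
    fun n => if 12 ≤ n then TwoSample.excess n else Real.exp 1 / 2 - 1, fun n h1 h2 => ?_⟩
  · have := TwoSample.dkwHolds_of_threeTermLe.{u} (by omega) (by norm_num)
      (TwoSample.threeTermLe_of_four_le hn)
    rwa [mul_div_cancel₀ _ two_ne_zero] at this
  · by_contra hlt
    exact TwoSample.not_canReject hn.1 (not_le.1 hlt) hn.2
  · have := TwoSample.dkwHolds_of_threeTermLe.{u} (by omega) zero_le_one
      (TwoSample.threeTermLe_one hn)
    rwa [mul_one] at this
  · obtain ⟨k, hk1, hkn, hlt⟩ := TwoSample.exists_exp_lt h1 h2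
    exact ⟨k, hk1, by rwa [Nat.lcm_self], TwoSample.dkwFailsAt_of_lt h1 hk1 hlt⟩
  · dsimp only
    split_ifs with h
    · have hpos := TwoSample.excess_pos h h2
      refine ⟨hpos, TwoSample.dkwHolds_of_threeTermLe h1 (by linarith)
        (TwoSample.threeTermLe_excess h h2), fun _ => ?_⟩
      unfold TwoSample.excess
      norm_num
    · refine ⟨by linarith [Real.exp_one_gt_d9], ?_, fun h' => absurd h' h⟩
      have e : 2 * (1 + (Real.exp 1 / 2 - 1)) = Real.exp 1 := by ring
      rw [e]
      exact ha n h1
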